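/- For a prime power $q$ and a tuple $\mathbf l=(l_1,\dots,l_s)$ of nonnegative integers, let $M^{\mathbf l}(q)$ be the set of block upper triangular matrices over $\mathbb F_q$ with diagonal blocks of sizes $l_1,\dots,l_s$ (arbitrary entries in and above the diagonal blocks), let $P^{\mathbf l}(q)$ be the group of invertible matrices in $M^{\mathbf l}(q)$, and let $N^{\mathbf l}(q)$ be the set of nilpotent matrices in $M^{\mathbf l}(q)$. The group $P^{\mathbf l}(q)$ acts on each of these sets by conjugation; write $\gamma(P^{\mathbf l}(q),X)$ for the number of its orbits on $X$, and $\rho_{\mathbf l}(q)=\gamma(P^{\mathbf l}(q),N^{\mathbf l}(q))$. Let $\mathscr D(\mathbf l)$ be the (finite) set of all families $J=(\mathbf l^1,\dots,\mathbf l^n,d_1,\dots,d_n)$, $n\ge 0$, where each $\mathbf l^i$ is an $s$-tuple of nonnegative integers, not all zero, each $d_i$ is a positive integer, and $\sum_{i=1}^n d_i\mathbf l^i=\mathbf l$, two families being identified if they differ by a simultaneous permutation of the indices $1,\dots,n$. Let $\mathbf l=(l_1,\dots,l_s)$ be a tuple of nonnegative integers. Then there exist tuples $(a_J)_{J\in\mathscr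 D(\mathbf l)}$ and $(b_J)_{J\in\mathscr D(\mathbf l)}$ of polynomials $a_J,b_J\in\mathbb Q[T]$ such that, for all prime powers $q$, $$\gamma(P^{\mathbf l}(q),P^{\mathbf l}(q))=\sum_{J\in\mathscr D(\mathbf l)}a_J(q)\prod_{i=1}^n\rho_{\mathbf l^i}(q^{d_i}) \quad\text{and}\quad \gamma(P^{\mathbf l}(q),M^{\mathbf l}(q))=\sum_{J\in\mathscr D(\mathbf l)}b_J(q)\prod_{i=1}^n\rho_{\mathbf l^i}(q^{d_i}),$$ where $J=(\mathbf l^1,\dots,\mathbf l^n,d_1,\dots,d_n)$. -/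

import Mathlib

/-- The row and column indices of matrices of block shape `l = (l₁, …, lₛ)`: pairs consisting of a
block and a position inside that block. -/
abbrev BlockIndex {s : ℕ} (l : Fin s → ℕ) : Type := Σ i : Fin s, Fin (l i)

/-- `M^l(K)`: block upper triangular matrices with diagonal blocks of sizes `l₁, …, lₛ`. -/
def blockMatrices (K : Type*) [Field K] {s : ℕ} (l : Fin s → ℕ) :
    Set (Matrix (BlockIndex l) (BlockIndex l) K) :=
  {A | A.BlockTriangular Sigma.fst}

/-- `N^l(K)`: the nilpotent matrices in `M^l(K)`. -/
def nilpotentBlockMatrices (K : Type*) [Field K] {s : ℕ} (l : Fin s → ℕ) :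
    Set (Matrix (BlockIndex l) (BlockIndex l) K) :=
  {A | A ∈ blockMatrices K l ∧ IsNilpotent A}

/-- The parabolic group `P^l(K)`: all invertible matrices in `M^l(K)`. -/
def parabolic (K : Type*) [Field K] {s : ℕ} (l : Fin s → ℕ) :
    Subgroup (GL (BlockIndex l) K) where
  carrier := {g | (g : Matrix (BlockIndex l) (BlockIndex l) K) ∈ blockMatrices K l}
  mul_mem' := by
    intro a b ha hb
    exact Matrix.BlockTriangular.mul ha hb
  one_mem' := Matrix.blockTriangular_one
  inv_mem' := by
    intro g hg
    have h : (g : Matrix (BlockIndex l) (BlockIndex l) K).BlockTriangular Sigma.fst := hg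
    have : Invertible (g : Matrix (BlockIndex l) (BlockIndex l) K) := g.invertible
    have h' := Matrix.blockTriangular_inv_of_blockTriangular h
    rw [← Matrix.coe_units_inv] at h'
    exact h'

/-- The underlying set of matrices of `P^l(K)`. -/
def parabolicMatrices (K : Type*) [Field K] {s : ℕ} (l : Fin s → ℕ) :
    Set (Matrix (BlockIndex l) (BlockIndex l) K) :=
  {A | ∃ g ∈ parabolic K l, (g : Matrix (BlockIndex l) (BlockIndex l) K) = A}

/-- The relation "`x` and `y` lie in the same orbit of `G` for the action `ᵍx = g x g⁻¹`", on a set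
`X` of matrices. -/
def conjSetoid {ι K : Type*} [Fintype ι] [DecidableEq ι] [Field K]
    (G : Subgroup (GL ι K)) (X : Set (Matrix ι ι K)) : Setoid X where
  r x y := ∃ g ∈ G, (g : Matrix ι ι K) * (x : Matrix ι ι K) * ((g⁻¹ : GL ι K) : Matrix ι ι K) = y
  iseqv :=
    { refl := fun x => ⟨1, G.one_mem, by simp⟩
      symm := by
        rintro x y ⟨g, hg, h⟩
        refine ⟨g⁻¹, G.inv_mem hg, ?_⟩
        rw [← h, inv_inv]
        simp only [mul_assoc, Units.inv_mul, mul_one, Units.inv_mul_cancel_left]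
      trans := by
        rintro x y z ⟨g, hg, h⟩ ⟨k, hk, h'⟩
        refine ⟨k * g, G.mul_mem hk hg, ?_⟩
        rw [← h', ← h, mul_inv_rev]
        simp only [Units.val_mul, mul_assoc] }

/-- `γ(G, X)`: the number of orbits of `G` acting by conjugation on a `G`-stable set `X` of
matrices. -/
noncomputable def orbitCount {ι K : Type*} [Fintype ι] [DecidableEq ι] [Field K]
    (G : Subgroup (GL ι K)) (X : Set (Matrix ι ι K)) : ℕ :=
  Nat.card (Quotient (conjSetoid G X))

/-- `ρ_l` of the field `K`: the number `γ(P^l(K), N^l(K))`. -/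
noncomputable def rho (K : Type*) [Field K] {s : ℕ} (l : Fin s → ℕ) : ℕ :=
  orbitCount (parabolic K l) (nilpotentBlockMatrices K l)

/-- The set `D(l)` of unordered families of pairs `(lⁱ, dᵢ)`, where each `lⁱ` is a nonzero `s`-tuple
of nonnegative integers, each `dᵢ` is a positive integer and `∑ dᵢ lⁱ = l`. A tuple of pairs up to
permutation is a multiset. -/
def decompositions {s : ℕ} (l : Fin s → ℕ) : Set (Multiset ((Fin s → ℕ) × ℕ)) :=
  {J | (∀ x ∈ J, x.1 ≠ 0 ∧ 1 ≤ x.2) ∧ (J.map fun x => x.2 • x.1).sum = l}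

theorem decompositions_finite {s : ℕ} (l : Fin s → ℕ) : (decompositions l).Finite := by
  classical
  set N := ∑ i, l i with hN
  let A : Finset ((Fin s → ℕ) × ℕ) := Finset.Iic (fun _ => N) ×ˢ Finset.range (N + 1)
  refine (Set.finite_Iic (N • A.val)).subset ?_
  rintro J ⟨hJ, hl⟩
  have key : (J.map fun x => x.2 * ∑ i, x.1 i).sum = N := by
    have h := congrArg
      (({ toFun := fun f => ∑ i, f i
          map_zero' := by simp
          map_add' := fun a b => by simp [Finset.sum_add_distrib] } : (Fin s → ℕ) →+ ℕ)) hl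
    rw [map_multiset_sum, Multiset.map_map] at h
    simpa [Function.comp_def, Finset.mul_sum] using h
  have hpos : ∀ x ∈ J, 1 ≤ ∑ i, x.1 i := by
    intro x hx
    by_contra hlt
    apply (hJ x hx).1
    have h0 : ∑ i, x.1 i = 0 := by omega
    funext i
    exact (Finset.sum_eq_zero_iff.mp h0) i (Finset.mem_univ i)
  have hle : ∀ x ∈ J, x.2 * ∑ i, x.1 i ≤ N := by
    intro x hx
    rw [← key]
    exact Multiset.single_le_sum (fun _ _ => Nat.zero_le _) _
      (Multiset.mem_map_of_mem (fun x : (Fin s → ℕ) × ℕ => x.2 * ∑ i, x.1 i) hx)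
  have hcard : Multiset.card J ≤ N := by
    rw [← key]
    have h := Multiset.card_nsmul_le_sum
      (s := J.map fun x : (Fin s → ℕ) × ℕ => x.2 * ∑ i, x.1 i) (a := 1) (by
        intro y hy
        obtain ⟨x, hx, rfl⟩ := Multiset.mem_map.mp hy
        exact Nat.mul_pos (hJ x hx).2 (hpos x hx))
    simpa using h
  change J ≤ N • A.val
  rw [Multiset.le_iff_count]
  intro x
  by_cases hx : x ∈ J
  · have hxA : x ∈ A := by
      have h1 := hle x hx
      have h2 := hpos x hx
      have h3 := (hJ x hx).2
      simp only [A, Finset.mem_product, Finset.mem_Iic, Finset.mem_range]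
      refine ⟨fun i => ?_, ?_⟩
      · have h4 : x.1 i ≤ ∑ i, x.1 i :=
          Finset.single_le_sum (fun _ _ => Nat.zero_le _) (Finset.mem_univ i)
        have h5 : ∑ i, x.1 i ≤ x.2 * ∑ i, x.1 i := Nat.le_mul_of_pos_left _ h3
        exact h4.trans (h5.trans h1)
      · have h5 : x.2 ≤ x.2 * ∑ i, x.1 i := Nat.le_mul_of_pos_right _ h2
        omega
    rw [Multiset.count_nsmul, Multiset.count_eq_one_of_mem A.nodup hxA, mul_one]
    exact (Multiset.count_le_card x J).trans hcard
  · rw [Multiset.count_eq_zero_of_notMem hx]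
    exact Nat.zero_le _

noncomputable instance decompositionsFintype {s : ℕ} (l : Fin s → ℕ) : Fintype (decompositions l) :=
  (decompositions_finite l).fintype

/-! Let `K` have `q` elements. A matrix `A` in `M^l(K)` makes column space a `K[X]`-module on which
`X` acts as `A`, and block triangularity says that the standard flag consists of submodules. Two
such matrices are conjugate under `P^l(K)` exactly when the modules with flags are isomorphic, so
orbits become isomorphism classes of flag modules of type `l` (`orbit_equiv`). Nilpotent matrices
correspond to the `X`-primary modules.

Primary decomposition respects flags, because the projections onto primary components are
multiplications by polynomials. Hence the generating series over `l` of the numbers of `g`-primary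
classes is multiplicative in coprime `g` (`primaryCount_mul`). If `f` is irreducible of degree `d`
and `E` is the field with `q ^ d` elements, then `K[X]/(f ^ N)` is isomorphic to `E[X]/(X ^ N)`. So
the `f`-primary series is the series of the numbers `rho E m` with exponents scaled by `d`
(`primaryCount_irreducible`); it depends on `f` only through `d`.

All block matrices together therefore have the series `∏ d, R_d ^ ν_d(q)`, where `R_d` is the scaled
series and `ν_d(q)` counts the monic irreducibles of degree `d`; only `d ≤ ∑ i, l i` matter for the
coefficient at `l`. Invertibility removes the factor of `f = X`. Since `ν_d(q)` is a polynomial in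
`q` and `R_d` has constant term `1`, the binomial expansion writes each coefficient as a combination
of products of numbers `rho` with coefficients polynomial in `q` (`IsGraded.one_add_pow`). -/

open Polynomial UniqueFactorizationMonoid

/-! ### Flag modules, their types and restriction of scalars -/

/-- A finite `R`-module with an exhaustive increasing chain of submodules of length `s`. -/
structure FlagModule (R : Type) [CommRing R] (s : ℕ) where
  carrier : Type
  [addCommGroup : AddCommGroup carrier]
  [module : Module R carrier]
  [finite : Finite carrier]
  flag : ℕ → Submodule R carrier
  mono : Monotone flag
  flag_zero : flag 0 = ⊥
  flag_last : flag s = ⊤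

namespace FlagModule

attribute [instance] FlagModule.addCommGroup FlagModule.module FlagModule.finite

variable {R S : Type} [CommRing R] [CommRing S] {s : ℕ}

/-- Isomorphism of flag modules. -/
def Iso (M N : FlagModule R s) : Prop :=
  ∃ e : M.carrier ≃ₗ[R] N.carrier, ∀ i x, e x ∈ N.flag i ↔ x ∈ M.flag i

theorem Iso.refl (M : FlagModule R s) : M.Iso M := ⟨LinearEquiv.refl R _, fun _ _ => Iff.rfl⟩

theorem Iso.symm {M N : FlagModule R s} : M.Iso N → N.Iso M := by
  rintro ⟨e, he⟩
  exact ⟨e.symm, fun i x => by rw [← he, e.apply_symm_apply]⟩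

theorem Iso.trans {M N Q : FlagModule R s} : M.Iso N → N.Iso Q → M.Iso Q := by
  rintro ⟨e, he⟩ ⟨e', he'⟩
  exact ⟨e.trans e', fun i x => by rw [LinearEquiv.trans_apply, he', he]⟩

/-- The isomorphism relation on the flag modules with the property `P`. -/
def isoSetoid (P : FlagModule R s → Prop) : Setoid {M : FlagModule R s // P M} where
  r M N := M.1.Iso N.1
  iseqv := ⟨fun M => Iso.refl M.1, fun h => h.symm, fun h h' => h.trans h'⟩

/-- The number of isomorphism classes of flag modules with the property `P`. -/
noncomputable def count (P : FlagModule R s → Prop) : ℕ := Nat.card (Quotient (isoSetoid P))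

theorem _root_.Nat.card_quotient_eq_of_map {α : Type*} {β : Type*} (a : Setoid α) (b : Setoid β)
    (f : α → β) (hf : ∀ x y, a.r x y ↔ b.r (f x) (f y)) (hs : ∀ y, ∃ x, b.r (f x) y) :
    Nat.card (Quotient a) = Nat.card (Quotient b) := by
  refine Nat.card_congr (Equiv.ofBijective (Quotient.map f fun x y h => (hf x y).1 h) ⟨?_, ?_⟩)
  · rintro ⟨x⟩ ⟨y⟩ h
    exact Quotient.sound ((hf x y).2 (Quotient.exact h))
  · rintro ⟨y⟩
    obtain ⟨x, hx⟩ := hs y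
    exact ⟨Quotient.mk _ x, Quotient.sound hx⟩

theorem count_congr {P Q : FlagModule R s → Prop} (h : ∀ M, P M ↔ Q M) : count P = count Q := by
  rw [show P = Q from funext fun M => propext (h M)]

theorem count_eq_zero {P : FlagModule R s → Prop} (h : ∀ M, ¬ P M) : count P = 0 := by
  have : IsEmpty {M : FlagModule R s // P M} := ⟨fun M => h M.1 M.2⟩
  have : IsEmpty (Quotient (isoSetoid P)) := ⟨fun x => Quotient.inductionOn x isEmptyElim⟩
  exact Nat.card_of_isEmpty

/-- The successive quotients of the flag have `q ^ l i` elements. -/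
def HasType (q : ℕ) (l : Fin s → ℕ) (M : FlagModule R s) : Prop :=
  ∀ i : Fin s, Nat.card (M.flag (i + 1)) = Nat.card (M.flag i) * q ^ l i

/-- A power of `g` annihilates `M`. -/
def IsPrimary (g : R) (M : FlagModule R s) : Prop := ∃ n : ℕ, ∀ x : M.carrier, g ^ n • x = 0

theorem Iso.card_flag {M N : FlagModule R s} (h : M.Iso N) (i : ℕ) :
    Nat.card (M.flag i) = Nat.card (N.flag i) := by
  obtain ⟨e, he⟩ := h
  exact Nat.card_congr (e.toEquiv.subtypeEquiv fun x => (he i x).symm)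

theorem Iso.hasType {q : ℕ} {l : Fin s → ℕ} {M N : FlagModule R s} (h : M.Iso N)
    (hM : M.HasType q l) : N.HasType q l := fun i => by
  rw [← h.card_flag, ← h.card_flag, hM i]

theorem Iso.isPrimary {g : R} {M N : FlagModule R s} (h : M.Iso N) (hM : M.IsPrimary g) :
    N.IsPrimary g := by
  obtain ⟨e, -⟩ := h
  obtain ⟨n, hn⟩ := hM
  refine ⟨n, fun x => ?_⟩
  rw [← e.apply_symm_apply x, ← map_smul, hn, map_zero]

theorem card_flag_pos (M : FlagModule R s) (i : ℕ) : 0 < Nat.card (M.flag i) := Nat.card_pos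

theorem HasType.unique {q : ℕ} (hq : 2 ≤ q) {l l' : Fin s → ℕ} {M : FlagModule R s}
    (h : M.HasType q l) (h' : M.HasType q l') : l = l' := by
  funext i
  have := (h i).symm.trans (h' i)
  exact Nat.pow_right_injective hq (Nat.eq_of_mul_eq_mul_left (M.card_flag_pos i) this)

/-- Over an algebra over a finite field every flag module has a type. -/
theorem exists_hasType (K : Type) [Field K] [Finite K] [Algebra K R] (M : FlagModule R s) :
    ∃ l, M.HasType (Nat.card K) l := by
  let _ : Module K M.carrier := Module.compHom _ (algebraMap K R)
  have : IsScalarTower K R M.carrier := ⟨fun a r x => by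
    rw [Algebra.smul_def, mul_smul]; rfl⟩
  have hc (i : ℕ) : Nat.card (M.flag i) =
      Nat.card K ^ Module.finrank K ((M.flag i).restrictScalars K) :=
    Module.natCard_eq_pow_finrank (K := K) (V := (M.flag i).restrictScalars K)
  refine ⟨fun i => Module.finrank K ((M.flag (i + 1)).restrictScalars K) -
    Module.finrank K ((M.flag i).restrictScalars K), fun i => ?_⟩
  have hle : Module.finrank K ((M.flag i).restrictScalars K) ≤
      Module.finrank K ((M.flag (i + 1)).restrictScalars K) :=
    Submodule.finrank_mono (fun x hx => M.mono (Nat.le_succ _) hx)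
  rw [hc, hc, ← pow_add, Nat.add_sub_cancel' hle]

theorem HasType.card {q : ℕ} {l : Fin s → ℕ} {M : FlagModule R s} (h : M.HasType q l) :
    Nat.card M.carrier = q ^ ∑ i, l i := by
  have key : ∀ n (hn : n ≤ s), Nat.card (M.flag n) = q ^ ∑ i : Fin n, l (Fin.castLE hn i) := by
    intro n
    induction n with
    | zero => intro _; simp [M.flag_zero]
    | succ n ih =>
      intro hn
      rw [h ⟨n, hn⟩, ih (by omega), ← pow_add, Fin.sum_univ_castSucc]
      rfl
  have := key s le_rfl
  rw [M.flag_last] at this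
  simpa using this

/-- Restriction of scalars. -/
def restrict (φ : R →+* S) (M : FlagModule S s) : FlagModule R s :=
  letI : Module R M.carrier := Module.compHom _ φ
  { carrier := M.carrier
    flag := fun i =>
      { carrier := M.flag i
        add_mem' := (M.flag i).add_mem
        zero_mem' := (M.flag i).zero_mem
        smul_mem' := fun r _ hx => (M.flag i).smul_mem (φ r) hx }
    mono := fun _ _ h _ hx => M.mono h hx
    flag_zero := by
      ext x
      change x ∈ M.flag 0 ↔ _
      simp [M.flag_zero]
    flag_last := by
      ext x
      change x ∈ M.flag s ↔ _
      simp [M.flag_last] }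

theorem restrict_iso_iff {φ : R →+* S} (hφ : Function.Surjective φ) (M N : FlagModule S s) :
    M.Iso N ↔ (M.restrict φ).Iso (N.restrict φ) := by
  constructor
  · rintro ⟨e, he⟩
    exact ⟨{ e.toAddEquiv with map_smul' := fun r x => e.map_smul (φ r) x }, he⟩
  · rintro ⟨e, he⟩
    refine ⟨{ e.toAddEquiv with map_smul' := fun r x => ?_ }, he⟩
    obtain ⟨r, rfl⟩ := hφ r
    exact e.map_smul r x

/-- Since the kernel of `φ` acts as zero, the action of `R` on `M` factors through `S`. -/
theorem exists_restrict {φ : R →+* S} (hφ : Function.Surjective φ) (M : FlagModule R s)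
    (hM : ∀ r, φ r = 0 → ∀ x : M.carrier, r • x = 0) :
    ∃ N : FlagModule S s, (N.restrict φ).Iso M := by
  let ψ : S →+* AddMonoid.End M.carrier := φ.liftOfSurjective hφ
    ⟨Module.toAddMonoidEnd R M.carrier, fun r hr => by
      ext x
      exact hM r hr x⟩
  have hψ (r : R) (x : M.carrier) : ψ (φ r) x = r • x := by
    have := φ.liftOfRightInverse_comp_apply _ (Function.rightInverse_surjInv hφ)
      ⟨Module.toAddMonoidEnd R M.carrier, fun r hr => by
        ext x
        exact hM r hr x⟩ r
    exact congrArg (fun f : AddMonoid.End M.carrier => f x) this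
  let _ : Module S M.carrier := Module.compHom _ ψ
  refine ⟨{ carrier := M.carrier
            flag := fun i =>
              { carrier := M.flag i
                add_mem' := (M.flag i).add_mem
                zero_mem' := (M.flag i).zero_mem
                smul_mem' := fun r x hx => by
                  obtain ⟨r, rfl⟩ := hφ r
                  change ψ (φ r) x ∈ M.flag i
                  rw [hψ]
                  exact (M.flag i).smul_mem r hx }
            mono := fun _ _ h _ hx => M.mono h hx
            flag_zero := by
              ext x
              change x ∈ M.flag 0 ↔ _
              simp [M.flag_zero]
            flag_last := by
              ext x
              change x ∈ M.flag s ↔ _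
              simp [M.flag_last] }, ?_⟩
  exact ⟨{ AddEquiv.refl M.carrier with map_smul' := fun r x => hψ r x }, fun _ _ => Iff.rfl⟩

/-- Flag modules over a quotient ring are flag modules over the ring annihilated by the kernel. -/
theorem count_restrict {φ : R →+* S} (hφ : Function.Surjective φ) {g : R}
    (hg : ∀ r, φ r = 0 ↔ g ∣ r) (q : ℕ) (l : Fin s → ℕ) :
    count (fun M : FlagModule S s => M.HasType q l) =
      count fun M : FlagModule R s => M.HasType q l ∧ ∀ x : M.carrier, g • x = 0 := by
  refine Nat.card_quotient_eq_of_map _ _ (fun M => ⟨M.1.restrict φ, M.2, fun x => ?_⟩) ?_ ?_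
  · change φ g • (show M.1.carrier from x) = 0
    rw [(hg g).2 dvd_rfl, zero_smul]
  · intro M N
    exact restrict_iso_iff hφ M.1 N.1
  · rintro ⟨M, hM, hk⟩
    obtain ⟨N, hN⟩ := exists_restrict hφ M fun r hr x => by
      obtain ⟨c, rfl⟩ := (hg r).1 hr
      rw [mul_comm, mul_smul, hk, smul_zero]
    exact ⟨⟨N, hN.symm.hasType hM⟩, hN⟩

end FlagModule

/-! ### Primary decomposition of flag modules -/

namespace FlagModule

variable {R S : Type} [CommRing R] [CommRing S] {s : ℕ}

/-- The direct sum of two flag modules. -/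
def prod (M N : FlagModule R s) : FlagModule R s where
  carrier := M.carrier × N.carrier
  flag i := (M.flag i).prod (N.flag i)
  mono _ _ h := Submodule.prod_mono (M.mono h) (N.mono h)
  flag_zero := by simp [M.flag_zero, N.flag_zero]
  flag_last := by simp [M.flag_last, N.flag_last]

theorem card_flag_prod (M N : FlagModule R s) (i : ℕ) :
    Nat.card ((M.prod N).flag i) = Nat.card (M.flag i) * Nat.card (N.flag i) := by
  rw [← Nat.card_prod]
  exact Nat.card_congr (Equiv.Set.prod (M.flag i : Set M.carrier) (N.flag i : Set N.carrier))

theorem HasType.prod {q : ℕ} {l l' : Fin s → ℕ} {M N : FlagModule R s} (hM : M.HasType q l)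
    (hN : N.HasType q l') : (M.prod N).HasType q (l + l') := fun i => by
  rw [card_flag_prod, card_flag_prod, hM i, hN i, Pi.add_apply, pow_add]
  ring

theorem Iso.prod {M M' N N' : FlagModule R s} (h : M.Iso M') (h' : N.Iso N') :
    (M.prod N).Iso (M'.prod N') := by
  obtain ⟨e, he⟩ := h
  obtain ⟨e', he'⟩ := h'
  refine ⟨e.prodCongr e', ?_⟩
  rintro i ⟨x, y⟩
  exact and_congr (he i x) (he' i y)

theorem IsPrimary.prod {g h : R} {M N : FlagModule R s} (hM : M.IsPrimary g) (hN : N.IsPrimary h) :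
    (M.prod N).IsPrimary (g * h) := by
  obtain ⟨m, hm⟩ := hM
  obtain ⟨n, hn⟩ := hN
  refine ⟨m + n, ?_⟩
  rintro ⟨x, y⟩
  change ((g * h) ^ (m + n) • x, (g * h) ^ (m + n) • y) = 0
  have e1 : (g * h) ^ (m + n) = (g ^ n * h ^ (m + n)) * g ^ m := by ring
  have e2 : (g * h) ^ (m + n) = (g ^ (m + n) * h ^ m) * h ^ n := by ring
  refine Prod.ext ?_ ?_
  · change (g * h) ^ (m + n) • x = 0
    rw [e1, mul_smul, hm, smul_zero]
  · change (g * h) ^ (m + n) • y = 0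
    rw [e2, mul_smul, hn, smul_zero]

theorem eq_zero_of_coprime {A : Type*} [AddCommGroup A] [Module R A] {a b : R}
    (h : IsCoprime a b) {x : A} (ha : a • x = 0) (hb : b • x = 0) : x = 0 := by
  obtain ⟨u, v, h⟩ := h
  rw [← one_smul R x, ← h, add_smul, mul_smul, mul_smul, ha, hb, smul_zero, smul_zero, add_zero]

/-- There is no nonzero linear map from a `g`-primary to an `h`-primary module: its values are
killed by powers of both `g` and `h`. So the isomorphism and its inverse carry first summands to
first summands. -/
theorem Iso.fst {g h : R} (hgh : IsCoprime g h) {M M' N N' : FlagModule R s} (hM : M.IsPrimary g)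
    (hM' : M'.IsPrimary g) (hN : N.IsPrimary h) (hN' : N'.IsPrimary h)
    (hiso : (M.prod N).Iso (M'.prod N')) : M.Iso M' := by
  obtain ⟨e, he⟩ := hiso
  have aux {M N M' N' : FlagModule R s} (hM : M.IsPrimary g) (hN' : N'.IsPrimary h)
      (f : (M.carrier × N.carrier) →ₗ[R] M'.carrier × N'.carrier) (x : M.carrier) :
      (f (x, 0)).2 = 0 := by
    obtain ⟨m, hm⟩ := hM
    obtain ⟨n, hn⟩ := hN'
    refine eq_zero_of_coprime (hgh.pow (m := m) (n := n)) ?_ (hn _)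
    rw [← Prod.smul_snd, ← map_smul, Prod.smul_mk, hm, smul_zero, Prod.mk_zero_zero, map_zero,
      Prod.snd_zero]
  let e' : (M.carrier × N.carrier) ≃ₗ[R] M'.carrier × N'.carrier := e
  have h1 (x : M.carrier) : e' (x, 0) = ((e' (x, 0)).1, 0) :=
    Prod.ext rfl (aux hM hN' e'.toLinearMap x)
  have h2 (x : M'.carrier) : e'.symm (x, 0) = ((e'.symm (x, 0)).1, 0) :=
    Prod.ext rfl (aux hM' hN e'.symm.toLinearMap x)
  refine ⟨LinearEquiv.ofLinearMap
    (LinearMap.fst R _ _ ∘ₗ e'.toLinearMap ∘ₗ LinearMap.inl R _ _)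
    (LinearMap.fst R _ _ ∘ₗ e'.symm.toLinearMap ∘ₗ LinearMap.inl R _ _) ?_ ?_, fun i x => ?_⟩
  · ext x
    change (e' ((e'.symm (x, 0)).1, 0)).1 = x
    rw [← h2, e'.apply_symm_apply]
  · ext x
    change (e'.symm ((e' (x, 0)).1, 0)).1 = x
    rw [← h1, e'.symm_apply_apply]
  · change (e' (x, 0)).1 ∈ M'.flag i ↔ _
    have := he i (x, 0)
    change e' (x, 0) ∈ (M'.flag i).prod (N'.flag i) ↔ (x, 0) ∈ (M.flag i).prod (N.flag i) at this
    rw [h1] at this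
    simpa using this

theorem prod_comm_iso (M N : FlagModule R s) : (M.prod N).Iso (N.prod M) :=
  ⟨LinearEquiv.prodComm R M.carrier N.carrier, fun _ _ => and_comm⟩

theorem Iso.snd {g h : R} (hgh : IsCoprime g h) {M M' N N' : FlagModule R s} (hM : M.IsPrimary g)
    (hM' : M'.IsPrimary g) (hN : N.IsPrimary h) (hN' : N'.IsPrimary h)
    (hiso : (M.prod N).Iso (M'.prod N')) : N.Iso N' :=
  Iso.fst hgh.symm hN hN' hM hM'
    (((prod_comm_iso N M).trans hiso).trans (prod_comm_iso M' N'))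

/-- A submodule with the induced flag. -/
def sub (M : FlagModule R s) (A : Submodule R M.carrier) : FlagModule R s where
  carrier := A
  flag i := (M.flag i).comap A.subtype
  mono _ _ h := Submodule.comap_mono (M.mono h)
  flag_zero := by simp [M.flag_zero]
  flag_last := by simp [M.flag_last]

/-- By Bézout the torsion submodules of `g ^ n` and `h ^ n` are complementary. The projections are
multiplications by ring elements, so they preserve each step of the flag, which therefore splits
too. -/
theorem exists_prod_iso {g h : R} (hgh : IsCoprime g h) (M : FlagModule R s)
    (hM : M.IsPrimary (g * h)) :
    ∃ A B : FlagModule R s, A.IsPrimary g ∧ B.IsPrimary h ∧ (A.prod B).Iso M := by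
  obtain ⟨n, hn⟩ := hM
  obtain ⟨a, b, hab⟩ := hgh.pow (m := n) (n := n)
  let A := Submodule.torsionBy R M.carrier (g ^ n)
  let B := Submodule.torsionBy R M.carrier (h ^ n)
  have hA (x : A) : g ^ n • (x : M.carrier) = 0 := x.2
  have hB (x : B) : h ^ n • (x : M.carrier) = 0 := x.2
  have e1 (x : M.carrier) : x = (b * h ^ n) • x + (a * g ^ n) • x := by
    rw [← add_smul, add_comm, hab, one_smul]
  have hc : IsCompl A B := by
    refine ⟨Submodule.disjoint_def.2 fun x hx hy => eq_zero_of_coprime ⟨a, b, hab⟩ hx hy,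
      codisjoint_iff.2 (eq_top_iff.2 fun x _ => ?_)⟩
    rw [e1 x]
    refine Submodule.add_mem_sup ?_ ?_
    · change g ^ n • (b * h ^ n) • x = 0
      rw [← mul_smul, show g ^ n * (b * h ^ n) = b * (g * h) ^ n by ring, mul_smul, hn, smul_zero]
    · change h ^ n • (a * g ^ n) • x = 0
      rw [← mul_smul, show h ^ n * (a * g ^ n) = a * (g * h) ^ n by ring, mul_smul, hn, smul_zero]
  refine ⟨M.sub A, M.sub B, ⟨n, fun x => Subtype.ext (hA x)⟩, ⟨n, fun x => Subtype.ext (hB x)⟩,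
    A.prodEquivOfIsCompl B hc, ?_⟩
  rintro i ⟨(x : A), (y : B)⟩
  change (x : M.carrier) + (y : M.carrier) ∈ M.flag i ↔
    (x : M.carrier) ∈ M.flag i ∧ (y : M.carrier) ∈ M.flag i
  refine ⟨fun hxy => ?_, fun hxy => add_mem hxy.1 hxy.2⟩
  -- Multiplication by `b * h ^ n` is the projection onto `A` along `B`.
  have hx : (b * h ^ n) • ((x : M.carrier) + (y : M.carrier)) = x := by
    rw [smul_add, mul_smul b _ (y : M.carrier), hB, smul_zero, add_zero]
    conv_rhs => rw [e1 x, mul_smul a, hA, smul_zero, add_zero]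
  have hx' : (x : M.carrier) ∈ M.flag i := by
    rw [← hx]
    exact (M.flag i).smul_mem _ hxy
  exact ⟨hx', by simpa using sub_mem hxy hx'⟩

/-- The number of isomorphism classes of `g`-primary flag modules of type `l`. -/
noncomputable def primaryCount (q : ℕ) (g : R) (l : Fin s → ℕ) : ℕ :=
  count fun M : FlagModule R s => M.HasType q l ∧ M.IsPrimary g

/-- The direct sum gives a bijection from pairs of classes, over all splittings of `l` into two
types, to classes of `g * h`-primary modules. Finiteness is what allows `Nat.card` to be summed over
the splittings. -/
theorem primaryCount_mul (K : Type) [Field K] [Finite K] [Algebra K R] {g h : R}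
    (hgh : IsCoprime g h)
    (hg : ∀ l : Fin s → ℕ, Finite (Quotient (isoSetoid fun M : FlagModule R s =>
      M.HasType (Nat.card K) l ∧ M.IsPrimary g)))
    (hh : ∀ l : Fin s → ℕ, Finite (Quotient (isoSetoid fun M : FlagModule R s =>
      M.HasType (Nat.card K) l ∧ M.IsPrimary h)))
    (l : Fin s →₀ ℕ) :
    primaryCount (Nat.card K) (g * h) l = ∑ p ∈ Finset.HasAntidiagonal.antidiagonal l,
      primaryCount (Nat.card K) g p.1 * primaryCount (Nat.card K) h p.2 := by
  have hq : 2 ≤ Nat.card K := Finite.one_lt_card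
  let X (p : Finset.HasAntidiagonal.antidiagonal l) : Type 1 :=
      Quotient (isoSetoid fun M : FlagModule R s => M.HasType (Nat.card K) p.1.1 ∧ M.IsPrimary g) ×
      Quotient (isoSetoid fun M : FlagModule R s => M.HasType (Nat.card K) p.1.2 ∧ M.IsPrimary h)
  have : ∀ p, Finite (X p) := fun p =>
    have := hg p.1.1
    have := hh p.1.2
    inferInstanceAs (Finite (_ × _))
  let F (p : Finset.HasAntidiagonal.antidiagonal l) : X p →
      Quotient (isoSetoid fun M : FlagModule R s =>
        M.HasType (Nat.card K) l ∧ M.IsPrimary (g * h)) := fun c =>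
    Quotient.map₂ (fun M N => ⟨M.1.prod N.1, by
      have := M.2.1.prod N.2.1
      rwa [← Finsupp.coe_add, Finset.HasAntidiagonal.mem_antidiagonal.1 p.2] at this, M.2.2.prod N.2.2⟩)
      (fun M M' h1 N N' h2 => show (M.1.prod N.1).Iso (M'.1.prod N'.1) from Iso.prod h1 h2) c.1 c.2
  have hF : Function.Bijective (fun c : Σ p : Finset.HasAntidiagonal.antidiagonal l, X p => F c.1 c.2) := by
    constructor
    · rintro ⟨⟨⟨p1, p2⟩, hp⟩, c, d⟩ ⟨⟨⟨p1', p2'⟩, hp'⟩, c', d'⟩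
      induction c using Quotient.inductionOn with | _ M =>
      induction d using Quotient.inductionOn with | _ N =>
      induction c' using Quotient.inductionOn with | _ M' =>
      induction d' using Quotient.inductionOn with | _ N' =>
      intro h
      have h : (M.1.prod N.1).Iso (M'.1.prod N'.1) := Quotient.exact h
      have h1 := Iso.fst hgh M.2.2 M'.2.2 N.2.2 N'.2.2 h
      have h2 := Iso.snd hgh M.2.2 M'.2.2 N.2.2 N'.2.2 h
      obtain rfl : p1 = p1' := DFunLike.coe_injective ((h1.hasType M.2.1).unique hq M'.2.1)
      obtain rfl : p2 = p2' := DFunLike.coe_injective ((h2.hasType N.2.1).unique hq N'.2.1)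
      have h1' : (Quotient.mk (isoSetoid _) M) = Quotient.mk (isoSetoid _) M' := Quotient.sound h1
      have h2' : (Quotient.mk (isoSetoid _) N) = Quotient.mk (isoSetoid _) N' := Quotient.sound h2
      simp only [h1', h2']
    · intro c
      induction c using Quotient.inductionOn with | _ M =>
      obtain ⟨A, B, hA, hB, hiso⟩ := exists_prod_iso hgh M.1 M.2.2
      obtain ⟨a, ha⟩ := exists_hasType K A
      obtain ⟨b, hb⟩ := exists_hasType K B
      have hab := (hiso.hasType (ha.prod hb)).unique hq M.2.1
      refine ⟨⟨⟨(Finsupp.equivFunOnFinite.symm a, Finsupp.equivFunOnFinite.symm b), ?_⟩,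
        Quotient.mk _ ⟨A, ha, hA⟩, Quotient.mk _ ⟨B, hb, hB⟩⟩, Quotient.sound hiso⟩
      rw [Finset.HasAntidiagonal.mem_antidiagonal]
      exact DFunLike.coe_injective hab
  have := Nat.card_congr (Equiv.ofBijective _ hF)
  rw [Nat.card_sigma] at this
  simp only [X, Nat.card_prod] at this
  rw [primaryCount, count, ← this]
  exact Finset.sum_coe_sort (Finset.HasAntidiagonal.antidiagonal l) fun p =>
    primaryCount (Nat.card K) g p.1 * primaryCount (Nat.card K) h p.2

/-- Primary modules of a given type are annihilated by a fixed power. -/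
theorem HasType.isPrimary_iff {K : Type} [Field K] [Finite K] [Algebra K R] {g : R}
    {l : Fin s → ℕ} {M : FlagModule R s} (hM : M.HasType (Nat.card K) l) {N : ℕ}
    (hN : ∑ i, l i ≤ N) : M.IsPrimary g ↔ ∀ x : M.carrier, g ^ N • x = 0 := by
  refine ⟨?_, fun h => ⟨N, h⟩⟩
  rintro ⟨n, hn⟩ x
  let _ : Module K M.carrier := Module.compHom _ (algebraMap K R)
  have : IsScalarTower K R M.carrier := ⟨fun a r x => by
    rw [Algebra.smul_def, mul_smul]; rfl⟩
  have hcard := hM.card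
  rw [Module.natCard_eq_pow_finrank (K := K) (V := M.carrier)] at hcard
  have hfr := Nat.pow_right_injective (show 2 ≤ Nat.card K from Finite.one_lt_card) hcard
  let T : Module.End K M.carrier := Algebra.lsmul K K M.carrier g
  have hT (n : ℕ) (x : M.carrier) : (T ^ n) x = g ^ n • x := by
    rw [← map_pow]; rfl
  -- The kernels of the powers of `T` are stationary from the exponent `dim M = ∑ i, l i` on, so
  -- exponents `N` and `max n N` have the same kernel.
  have := Module.End.ker_pow_eq_ker_pow_finrank_of_le (f := T) (m := max n N) (by
    rw [hfr]; exact hN.trans (le_max_right _ _))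
  have h2 := Module.End.ker_pow_eq_ker_pow_finrank_of_le (f := T) (m := N) (by
    rw [hfr]; exact hN)
  have h3 : x ∈ LinearMap.ker (T ^ N) := by
    rw [h2, ← this, LinearMap.mem_ker, hT, ← Nat.sub_add_cancel (le_max_left n N), pow_add,
      mul_smul, hn, smul_zero]
  rw [← hT]
  exact h3

end FlagModule

/-! ### Linear algebra of the standard flag -/

/-- The standard flag of the space of column vectors of block shape `l`. -/
def stdFlag (K : Type*) [Field K] {s : ℕ} (l : Fin s → ℕ) (i : ℕ) :
    Submodule K (BlockIndex l → K) where
  carrier := {v | ∀ j, i ≤ (j.1 : ℕ) → v j = 0}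
  add_mem' := fun hv hw j hj => by simp [hv j hj, hw j hj]
  zero_mem' := fun _ _ => rfl
  smul_mem' := fun c v hv j hj => by simp [hv j hj]

section

variable {K : Type*} [Field K] {s : ℕ} {l : Fin s → ℕ}

theorem stdFlag_mono : Monotone (stdFlag K l) := fun _ _ h _ hv j hj => hv j (h.trans hj)

theorem stdFlag_zero : stdFlag K l 0 = ⊥ := by
  refine eq_bot_iff.2 fun v hv => ?_
  rw [Submodule.mem_bot]
  exact funext fun j => hv j (Nat.zero_le _)

theorem stdFlag_last : stdFlag K l s = ⊤ :=
  eq_top_iff.2 fun _ _ j hj => absurd j.1.2 (not_lt.2 hj)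

theorem card_stdFlag_succ (i : Fin s) :
    Nat.card (stdFlag K l (i + 1)) = Nat.card (stdFlag K l i) * Nat.card K ^ l i := by
  classical
  have h : Nat.card (Fin (l i) → K) = Nat.card K ^ l i := by simp [Nat.card_fun]
  rw [← h, ← Nat.card_prod]
  refine Nat.card_congr
    { toFun := fun v => (⟨fun j => if (j.1 : ℕ) < i then v.1 j else 0, fun j hj =>
        if_neg (not_lt.2 hj)⟩, fun k => v.1 ⟨i, k⟩)
      invFun := fun p => ⟨fun j => if h : j.1 = i then p.2 (h ▸ j.2) else p.1.1 j, fun j hj => by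
        exact (dif_neg (by rintro rfl; omega)).trans (p.1.2 j (by omega))⟩
      left_inv := ?_
      right_inv := ?_ }
  · rintro ⟨v, hv⟩
    ext ⟨j, k⟩
    by_cases h : j = i
    · subst h; simp
    · have h' : (j : ℕ) ≠ i := fun h' => h (Fin.ext h')
      simp only [h, dite_false]
      split_ifs with h2
      · rfl
      · exact (hv ⟨j, k⟩ (by simp only; omega)).symm
  · rintro ⟨⟨v, hv⟩, w⟩
    refine Prod.ext (Subtype.ext (funext ?_)) (funext fun k => by simp)
    rintro ⟨j, k⟩
    by_cases h2 : (j : ℕ) < i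
    · have h3 : j ≠ i := by rintro rfl; omega
      simp [h2, h3]
    · simp only [h2, if_false]
      exact (hv ⟨j, k⟩ (not_lt.1 h2)).symm

/-- A flag with given dimensions is isomorphic to the standard flag. -/
theorem exists_adapted_equiv {V : Type*} [AddCommGroup V] [Module K V] [FiniteDimensional K V]
    (F : ℕ → Submodule K V) (hF : Monotone F) (h0 : F 0 = ⊥) (hs : F s = ⊤)
    (hl : ∀ i : Fin s, Module.finrank K (F (i + 1)) = Module.finrank K (F i) + l i) :
    ∃ e : (BlockIndex l → K) ≃ₗ[K] V, ∀ i v, e v ∈ F i ↔ v ∈ stdFlag K l i := by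
  classical
  -- By the modular law, a complement of `F i` meets `F (i + 1)` in a relative complement. Bases of
  -- these together form the adapted basis `w`.
  have hC (i : ℕ) : ∃ C, F i ⊔ C = F (i + 1) ∧ F i ⊓ C = ⊥ := by
    obtain ⟨C, hC⟩ := exists_isCompl (F i)
    refine ⟨C ⊓ F (i + 1), ?_, ?_⟩
    · rw [← sup_inf_assoc_of_le C (hF (Nat.le_add_right i 1)), hC.sup_eq_top, top_inf_eq]
    · rw [← inf_assoc, hC.inf_eq_bot, bot_inf_eq]
  choose C hC1 hC2 using hC
  have hdim (i : Fin s) : Module.finrank K (C i) = l i := by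
    have := Submodule.finrank_sup_add_finrank_inf_eq (F i) (C i)
    rw [hC1, hC2, finrank_bot, hl] at this
    omega
  let b (i : Fin s) : Module.Basis (Fin (l i)) K (C i) := Module.finBasisOfFinrankEq K (C i) (hdim i)
  let w (j : BlockIndex l) : V := b j.1 j.2
  let Φ := Fintype.linearCombination K w
  have hΦ (v : BlockIndex l → K) : Φ v = ∑ j, v j • w j := rfl
  have hw (j : BlockIndex l) : w j ∈ F (j.1 + 1) := by
    rw [← hC1]
    exact Submodule.mem_sup_right (b j.1 j.2).2
  have hle (n : ℕ) : (stdFlag K l n).map Φ ≤ F n := by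
    rintro _ ⟨v, hv, rfl⟩
    rw [hΦ]
    refine Submodule.sum_mem _ fun j _ => ?_
    by_cases hj : n ≤ (j.1 : ℕ)
    · rw [hv j hj, zero_smul]; exact zero_mem _
    · exact Submodule.smul_mem _ _ (hF (by omega) (hw j))
  have hge (n : ℕ) (hn : n ≤ s) : F n ≤ (stdFlag K l n).map Φ := by
    induction n with
    | zero => rw [h0]; exact bot_le
    | succ n ih =>
      rw [← hC1]
      refine sup_le ((ih (by omega)).trans (Submodule.map_mono (stdFlag_mono (Nat.le_succ n)))) ?_
      intro z hz
      have hz' := congrArg Subtype.val ((b ⟨n, hn⟩).sum_repr ⟨z, hz⟩)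
      rw [← show _ = z from hz', Submodule.coe_sum]
      refine Submodule.sum_mem _ fun k _ => Submodule.smul_mem _ _ ?_
      refine ⟨Pi.single ⟨⟨n, hn⟩, k⟩ 1, fun j hj => Pi.single_eq_of_ne ?_ _, ?_⟩
      · rintro rfl
        simp at hj
      · exact (Fintype.linearCombination_apply_single K w _ 1).trans (one_smul K _)
  have hmap (n : ℕ) : (stdFlag K l n).map Φ = F n := by
    rcases le_total n s with h | h
    · exact le_antisymm (hle n) (hge n h)
    · refine le_antisymm (hle n) ?_
      rw [top_le_iff.1 (hs ▸ hF h : ⊤ ≤ F n), ← hs]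
      exact (hge s le_rfl).trans (Submodule.map_mono (stdFlag_mono h))
  have hsurj : Function.Surjective Φ := by
    rw [← LinearMap.range_eq_top, ← Submodule.map_top, ← stdFlag_last, hmap, hs]
  have hfr : Module.finrank K (BlockIndex l → K) = Module.finrank K V := by
    have key : ∀ n (hn : n ≤ s), Module.finrank K (F n) = ∑ i : Fin n, l (Fin.castLE hn i) := by
      intro n
      induction n with
      | zero => intro _; simp [h0]
      | succ n ih =>
        intro hn
        rw [hl ⟨n, hn⟩, ih (by omega), Fin.sum_univ_castSucc]
        rfl
    have := key s le_rfl
    rw [hs, finrank_top] at this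
    rw [this]
    simp
  have hinj : Function.Injective Φ := (LinearMap.injective_iff_surjective_of_finrank_eq_finrank hfr).2 hsurj
  refine ⟨LinearEquiv.ofBijective Φ ⟨hinj, hsurj⟩, fun i v => ?_⟩
  rw [← hmap]
  exact ⟨fun ⟨v', hv', h⟩ => hinj h ▸ hv', fun h => ⟨v, h, rfl⟩⟩

/-- This identifies `M^l` with the matrices stabilizing the standard flag. -/
theorem blockTriangular_iff_mulVec_mem {A : Matrix (BlockIndex l) (BlockIndex l) K} :
    A.BlockTriangular Sigma.fst ↔ ∀ i, ∀ v ∈ stdFlag K l i, A.mulVec v ∈ stdFlag K l i := by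
  classical
  constructor
  · intro hA i v hv j hj
    refine Finset.sum_eq_zero fun k _ => ?_
    by_cases hk : i ≤ (k.1 : ℕ)
    · simp [hv k hk]
    · have : A j k = 0 := hA (show k.1 < j.1 by rw [Fin.lt_def]; omega)
      simp [this]
  · intro h i j hij
    -- Blocks are numbered from `0`, so the `j`-th unit vector lies in step `j.1 + 1`; its image is
    -- the `j`-th column.
    have := h (j.1 + 1) (Pi.single j 1) (fun k hk => Pi.single_eq_of_ne (by rintro rfl; omega) _) i
      hij
    simpa using this

end

/-! ### Orbits of matrices as classes of flag modules over `K[X]` -/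

namespace FlagModule

section Matrix

variable {K : Type} [Field K] {s : ℕ} {l : Fin s → ℕ}

theorem blockTriangular_aeval {A : Matrix (BlockIndex l) (BlockIndex l) K}
    (hA : A ∈ blockMatrices K l) (g : K[X]) : aeval A g ∈ blockMatrices K l := by
  let B : Subalgebra K (Matrix (BlockIndex l) (BlockIndex l) K) :=
    { carrier := blockMatrices K l
      mul_mem' := fun ha hb => Matrix.BlockTriangular.mul ha hb
      add_mem' := fun ha hb => Matrix.BlockTriangular.add ha hb
      algebraMap_mem' := fun r => by
        rw [Matrix.algebraMap_eq_diagonal]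
        exact Matrix.blockTriangular_diagonal _ }
  rw [← show (((aeval (⟨A, hA⟩ : B)) g : B) : Matrix (BlockIndex l) (BlockIndex l) K) = aeval A g from
    (Polynomial.aeval_algHom_apply B.val (⟨A, hA⟩ : B) g).symm]
  exact (aeval (⟨A, hA⟩ : B) g).2

variable [Finite K]

/-- Column vectors as a flag module over `K[X]`, where `X` acts as the matrix `A`. -/
noncomputable def ofMatrix (A : Matrix (BlockIndex l) (BlockIndex l) K)
    (hA : A ∈ blockMatrices K l) : FlagModule K[X] s :=
  let _ : Module K[X] (BlockIndex l → K) := Module.compHom (BlockIndex l → K)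
    ((Matrix.toLinAlgEquiv' (R := K)).toAlgHom.comp (aeval A)).toRingHom
  { carrier := BlockIndex l → K
    flag := fun i =>
      { carrier := stdFlag K l i
        add_mem' := (stdFlag K l i).add_mem
        zero_mem' := (stdFlag K l i).zero_mem
        smul_mem' := fun g v hv =>
          blockTriangular_iff_mulVec_mem.1 (blockTriangular_aeval hA g) i v hv }
    mono := fun _ _ h _ hx => stdFlag_mono h hx
    flag_zero := by
      ext x
      change x ∈ stdFlag K l 0 ↔ _
      simp [stdFlag_zero]
    flag_last := by
      ext x
      change x ∈ stdFlag K l s ↔ _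
      simp [stdFlag_last] }

variable {A B : Matrix (BlockIndex l) (BlockIndex l) K} {hA : A ∈ blockMatrices K l}
  {hB : B ∈ blockMatrices K l}

theorem hasType_ofMatrix : (ofMatrix A hA).HasType (Nat.card K) l := fun i => card_stdFlag_succ i

theorem isPrimary_ofMatrix {g : K[X]} : (ofMatrix A hA).IsPrimary g ↔ IsNilpotent (aeval A g) := by
  refine exists_congr fun n => ?_
  rw [← map_pow]
  change (∀ x : BlockIndex l → K, (aeval A (g ^ n)).mulVec x = 0) ↔ _
  refine ⟨fun h => ?_, fun h x => by rw [h, Matrix.zero_mulVec]⟩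
  exact Matrix.toLin'.injective (LinearMap.ext fun x => by simpa only [Matrix.toLin'_apply, Matrix.zero_mulVec] using h x)

/-- A `K[X]`-isomorphism is a `K`-isomorphism intertwining the two actions of `X`, and preserving
the flag puts its matrix in the parabolic group. Conversely, intertwining `A` with `B` extends to
all polynomials in them. -/
theorem isoOfMatrix_iff : (ofMatrix A hA).Iso (ofMatrix B hB) ↔
    ∃ g ∈ parabolic K l, (g : Matrix (BlockIndex l) (BlockIndex l) K) * A *
      ((g⁻¹ : GL (BlockIndex l) K) : Matrix (BlockIndex l) (BlockIndex l) K) = B := by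
  constructor
  · rintro ⟨e, he⟩
    -- Constant polynomials act as scalars, whence `K`-linearity.
    let e' : (BlockIndex l → K) ≃ₗ[K] (BlockIndex l → K) :=
      { e.toAddEquiv with
        map_smul' := fun c x => by
          have h1 (A' : Matrix (BlockIndex l) (BlockIndex l) K) (y : BlockIndex l → K) :
              (aeval A' (C c)).mulVec y = c • y := by
            rw [aeval_C, Matrix.algebraMap_eq_diagonal]
            ext j
            simp [Matrix.mulVec_diagonal]
          have h2 : e (show BlockIndex l → K from (aeval A (C c)).mulVec x) =
            (aeval B (C c)).mulVec (e x) := e.map_smul (C c) x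
          exact (congrArg e (h1 A x).symm).trans (h2.trans (h1 B (e x))) }
    have hX (x : BlockIndex l → K) : e' (A.mulVec x) = B.mulVec (e' x) := by
      have h2 : e' ((aeval A (X : K[X])).mulVec x) = (aeval B (X : K[X])).mulVec (e' x) :=
        e.map_smul (X : K[X]) x
      simpa using h2
    have hflag (i : ℕ) (x : BlockIndex l → K) : e' x ∈ stdFlag K l i ↔ x ∈ stdFlag K l i := he i x
    let g : GL (BlockIndex l) K :=
      ⟨LinearMap.toMatrix' e'.toLinearMap, LinearMap.toMatrix' e'.symm.toLinearMap, by
        rw [← LinearMap.toMatrix'_mul]; ext; simp [Module.End.mul_eq_comp, Matrix.one_eq_pi_single, Pi.single_comm], by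
        rw [← LinearMap.toMatrix'_mul]; ext; simp [Module.End.mul_eq_comp, Matrix.one_eq_pi_single, Pi.single_comm]⟩
    have hg (x : BlockIndex l → K) :
        (g : Matrix (BlockIndex l) (BlockIndex l) K).mulVec x = e' x :=
      LinearMap.toMatrix'_mulVec e'.toLinearMap x
    refine ⟨g, ?_, ?_⟩
    · exact blockTriangular_iff_mulVec_mem.2 fun i v hv => by rwa [hg, hflag]
    · rw [Units.mul_inv_eq_iff_eq_mul]
      refine Matrix.toLin'.injective (LinearMap.ext fun x => ?_)
      simp only [Matrix.toLin'_apply, ← Matrix.mulVec_mulVec, hg, hX]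
  · rintro ⟨g, hg, hgA⟩
    have hg' := (parabolic K l).inv_mem hg
    have hp (p : K[X]) : (g : Matrix (BlockIndex l) (BlockIndex l) K) * aeval A p =
        aeval B p * (g : Matrix (BlockIndex l) (BlockIndex l) K) := by
      rw [Units.mul_inv_eq_iff_eq_mul] at hgA
      have : SemiconjBy (g : Matrix (BlockIndex l) (BlockIndex l) K) A B := hgA
      change SemiconjBy _ _ _
      induction p using Polynomial.induction_on' with
      | add p q hp hq => simpa using hp.add_right hq
      | monomial n c =>
        rw [aeval_monomial, aeval_monomial]
        exact SemiconjBy.mul_right (Algebra.commutes c _).symm (this.pow_right n)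
    have h1 (x : BlockIndex l → K) : (g : Matrix (BlockIndex l) (BlockIndex l) K).mulVec
        (((g⁻¹ : GL (BlockIndex l) K) : Matrix (BlockIndex l) (BlockIndex l) K).mulVec x) = x := by
      rw [Matrix.mulVec_mulVec, Units.mul_inv, Matrix.one_mulVec]
    have h2 (x : BlockIndex l → K) :
        ((g⁻¹ : GL (BlockIndex l) K) : Matrix (BlockIndex l) (BlockIndex l) K).mulVec
        ((g : Matrix (BlockIndex l) (BlockIndex l) K).mulVec x) = x := by
      rw [Matrix.mulVec_mulVec, Units.inv_mul, Matrix.one_mulVec]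
    refine ⟨{ toFun := fun x : BlockIndex l → K =>
                (g : Matrix (BlockIndex l) (BlockIndex l) K).mulVec x
              invFun := fun x : BlockIndex l → K =>
                ((g⁻¹ : GL (BlockIndex l) K) : Matrix (BlockIndex l) (BlockIndex l) K).mulVec x
              map_add' := fun x y => Matrix.mulVec_add _ _ _
              map_smul' := fun p x => ?_
              left_inv := h2
              right_inv := h1 }, fun i x => ?_⟩
    · change Matrix.mulVec _ ((aeval A p).mulVec (show BlockIndex l → K from x)) =
        (aeval B p).mulVec (Matrix.mulVec _ (show BlockIndex l → K from x))
      rw [Matrix.mulVec_mulVec, Matrix.mulVec_mulVec, hp]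
    · change Matrix.mulVec _ (show BlockIndex l → K from x) ∈ stdFlag K l i ↔
        (show BlockIndex l → K from x) ∈ stdFlag K l i
      refine ⟨fun h => ?_, fun h => blockTriangular_iff_mulVec_mem.1 hg i _ h⟩
      have := blockTriangular_iff_mulVec_mem.1 hg' i _ h
      rwa [h2] at this

/-- In a basis adapted to the flag, multiplication by `X` becomes a block triangular matrix. -/
theorem exists_ofMatrix_iso (M : FlagModule K[X] s) (hM : M.HasType (Nat.card K) l) :
    ∃ A, ∃ hA : A ∈ blockMatrices K l, (ofMatrix A hA).Iso M := by
  let _ : Module K M.carrier := Module.compHom _ (algebraMap K K[X])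
  have hsm (c : K) (x : M.carrier) : c • x = (C c : K[X]) • x := rfl
  have : IsScalarTower K K[X] M.carrier := ⟨fun a r x => by
    rw [Algebra.smul_def, mul_smul]; rfl⟩
  have hc (i : ℕ) : Nat.card (M.flag i) =
      Nat.card K ^ Module.finrank K ((M.flag i).restrictScalars K) :=
    Module.natCard_eq_pow_finrank (K := K) (V := (M.flag i).restrictScalars K)
  obtain ⟨e, he⟩ := exists_adapted_equiv (K := K) (l := l)
    (fun i => (M.flag i).restrictScalars K) (fun _ _ h _ hx => M.mono h hx)
    (by simp [M.flag_zero]) (by simp [M.flag_last]) (fun i => by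
      have := hM i
      rw [hc, hc, ← pow_add] at this
      exact Nat.pow_right_injective (show 2 ≤ Nat.card K from Finite.one_lt_card) this)
  let T : Module.End K M.carrier := Algebra.lsmul K K M.carrier (X : K[X])
  let A : Matrix (BlockIndex l) (BlockIndex l) K := LinearMap.toMatrix' (e.symm.conj T)
  have hAe (x : BlockIndex l → K) : e (A.mulVec x) = (X : K[X]) • e x := by
    rw [LinearMap.toMatrix'_mulVec, LinearEquiv.conj_apply_apply, e.apply_symm_apply]
    rfl
  have hA : A ∈ blockMatrices K l := blockTriangular_iff_mulVec_mem.2 fun i v hv => by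
    rw [← he, hAe]
    exact (M.flag i).smul_mem _ ((he i v).2 hv)
  have hp (p : K[X]) (x : BlockIndex l → K) : e ((aeval A p).mulVec x) = p • e x := by
    induction p using Polynomial.induction_on generalizing x with
    | C c =>
      rw [aeval_C, Matrix.algebraMap_eq_diagonal, ← hsm, ← map_smul]
      congr 1
      ext j
      simp [Matrix.mulVec_diagonal]
    | add p q hp hq => rw [map_add, Matrix.add_mulVec, map_add, hp, hq, add_smul]
    | monomial n c ih =>
      rw [pow_succ, ← mul_assoc, map_mul, aeval_X, ← Matrix.mulVec_mulVec, ih, hAe, mul_smul _ X]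
  exact ⟨A, hA, { e.toAddEquiv with map_smul' := fun p x => hp p x }, he⟩

/-- An equivalence, rather than an equality of cardinalities, also transfers finiteness from the
orbits to the classes. -/
theorem orbit_equiv (g : K[X]) : Nonempty
    (Quotient (conjSetoid (parabolic K l) {A | A ∈ blockMatrices K l ∧ IsNilpotent (aeval A g)}) ≃
      Quotient (isoSetoid fun M : FlagModule K[X] s =>
        M.HasType (Nat.card K) l ∧ M.IsPrimary g)) := by
  let f : {A | A ∈ blockMatrices K l ∧ IsNilpotent (aeval A g)} →
      {M : FlagModule K[X] s // M.HasType (Nat.card K) l ∧ M.IsPrimary g} := fun A =>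
    ⟨ofMatrix A.1 A.2.1, hasType_ofMatrix, isPrimary_ofMatrix.2 A.2.2⟩
  refine ⟨Equiv.ofBijective (Quotient.map f fun A B h =>
    (isoOfMatrix_iff (hA := A.2.1) (hB := B.2.1)).2 h) ⟨?_, ?_⟩⟩
  · rintro ⟨A⟩ ⟨B⟩ h
    exact Quotient.sound ((isoOfMatrix_iff (hA := A.2.1) (hB := B.2.1)).1 (Quotient.exact h))
  · rintro ⟨M⟩
    obtain ⟨A, hA, hiso⟩ := exists_ofMatrix_iso M.1 M.2.1
    exact ⟨Quotient.mk _ ⟨A, hA, isPrimary_ofMatrix.1 (hiso.symm.isPrimary M.2.2)⟩,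
      Quotient.sound hiso⟩

theorem orbitCount_eq_primaryCount (g : K[X]) :
    orbitCount (parabolic K l) {A | A ∈ blockMatrices K l ∧ IsNilpotent (aeval A g)} =
      primaryCount (Nat.card K) g l :=
  Nat.card_congr (orbit_equiv g).some

theorem finite_primary (g : K[X]) (l : Fin s → ℕ) :
    Finite (Quotient (isoSetoid fun M : FlagModule K[X] s =>
      M.HasType (Nat.card K) l ∧ M.IsPrimary g)) :=
  Finite.of_equiv _ (orbit_equiv g).some

theorem rho_eq_primaryCount (l : Fin s → ℕ) :
    rho K l = primaryCount (Nat.card K) (X : K[X]) l := by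
  rw [← orbitCount_eq_primaryCount]
  simp only [aeval_X]
  rfl

end Matrix

end FlagModule

/-! ### Truncations at an irreducible polynomial -/

section

variable {K E : Type*} [Field K] [Field E] [Algebra K E] {f : K[X]} {α : E}

theorem aeval_C_add_X (r : K[X]) :
    aeval (C α + X : E[X]) r = (r.map (algebraMap K E)).comp (C α + X) := by
  rw [comp, eval₂_map, aeval_def]
  rfl

theorem X_dvd_aeval_C_add_X_iff {r : K[X]} : X ∣ aeval (C α + X : E[X]) r ↔ aeval α r = 0 := by
  rw [aeval_C_add_X, X_dvd_iff, coeff_zero_eq_eval_zero, eval_comp]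
  simp [eval_map_algebraMap]

/-- By separability `f(α + X)` vanishes at `0` to order exactly one. So the order at `0` of `r(α +
X)` is the multiplicity of `f` in `r`. -/
theorem pow_X_dvd_aeval_C_add_X_iff (hf : Irreducible f) (hsep : f.Separable) (hα : aeval α f = 0)
    (N : ℕ) (r : K[X]) : X ^ N ∣ aeval (C α + X : E[X]) r ↔ f ^ N ∣ r := by
  obtain ⟨u, hu⟩ : X ∣ aeval (C α + X : E[X]) f := X_dvd_aeval_C_add_X_iff.2 hα
  -- Otherwise `X ^ 2` divides `f(α + X)` and `α` is a common root of `f` and its derivative.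
  have hu0 : ¬ X ∣ u := by
    rintro ⟨v, rfl⟩
    have h1 : derivative (aeval (C α + X : E[X]) f) = aeval (C α + X : E[X]) (derivative f) := by
      rw [aeval_C_add_X, aeval_C_add_X, derivative_comp, derivative_map]
      simp
    have h2 : X ∣ aeval (C α + X : E[X]) (derivative f) := by
      rw [← h1, hu]
      exact ⟨2 * v + X * derivative v, by simp; ring⟩
    have h3 := X_dvd_aeval_C_add_X_iff.1 h2
    obtain ⟨a, b, hab⟩ := hsep
    have := congrArg (aeval α) hab
    simp [hα, h3] at this
  constructor
  · induction N generalizing r with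
    | zero => simp
    | succ N ih =>
      intro h
      have h0 : aeval α r = 0 := X_dvd_aeval_C_add_X_iff.1 ((dvd_pow_self X (by simp)).trans h)
      obtain ⟨r', rfl⟩ : f ∣ r := by
        have := minpoly.dvd K α h0
        have h1 := minpoly.dvd K α hα
        refine ((hf.dvd_iff.1 h1).resolve_left (minpoly.not_isUnit K α)).dvd.trans this
      rw [map_mul, hu, pow_succ', mul_assoc] at h
      have h' := (mul_dvd_mul_iff_left X_ne_zero).1 h
      rw [pow_succ']
      refine mul_dvd_mul_left _ (ih r' ?_)
      refine IsCoprime.dvd_of_dvd_mul_left ?_ h'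
      exact (((irreducible_X (R := E)).coprime_iff_not_dvd).2 hu0).pow_left
  · rintro ⟨r', rfl⟩
    rw [map_mul, map_pow]
    exact (pow_dvd_pow_of_dvd ⟨u, hu⟩ N).mul_right _

/-- A truncated form of Cohen's structure theorem: `K[X]/(f ^ N)` is `E[X]/(X ^ N)`, where `E` is
the residue field of the separable irreducible polynomial `f`. -/
theorem exists_surjective_truncated [FiniteDimensional K E] (hf : Irreducible f)
    (hsep : f.Separable) (hα : aeval α f = 0) (hd : f.natDegree = Module.finrank K E) (N : ℕ) :
    ∃ φ : K[X] →+* E[X] ⧸ Ideal.span {(X ^ N : E[X])}, Function.Surjective φ ∧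
      ∀ r, φ r = 0 ↔ f ^ N ∣ r := by
  let φ : K[X] →ₐ[K] E[X] ⧸ Ideal.span {(X ^ N : E[X])} :=
    (Ideal.Quotient.mkₐ K _).comp (aeval (C α + X : E[X]))
  have hφ (r : K[X]) : φ r = 0 ↔ f ^ N ∣ r := by
    rw [← pow_X_dvd_aeval_C_add_X_iff hf hsep hα, ← Ideal.mem_span_singleton]
    exact Ideal.Quotient.eq_zero_iff_mem
  refine ⟨φ.toRingHom, ?_, hφ⟩
  have hX : (X ^ N : E[X]) ≠ 0 := pow_ne_zero _ X_ne_zero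
  have hfN : f ^ N ≠ 0 := pow_ne_zero _ hf.ne_zero
  let ψ : (K[X] ⧸ Ideal.span {f ^ N}) →ₐ[K] E[X] ⧸ Ideal.span {(X ^ N : E[X])} :=
    Ideal.Quotient.liftₐ _ φ fun a ha => (hφ a).2 (Ideal.mem_span_singleton.1 ha)
  have hψ (r : K[X]) : ψ (Ideal.Quotient.mk _ r) = φ r := rfl
  have hinj : Function.Injective ψ := by
    rw [injective_iff_map_eq_zero]
    intro a
    obtain ⟨a, rfl⟩ := Ideal.Quotient.mk_surjective a
    intro ha
    rw [hψ, hφ] at ha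
    exact Ideal.Quotient.eq_zero_iff_mem.2 (Ideal.mem_span_singleton.2 ha)
  -- Both quotients have dimension `N * f.natDegree` over `K`, so the injective map between them is
  -- surjective.
  have e1 : Module.finrank K (K[X] ⧸ Ideal.span {f ^ N}) = N * f.natDegree := by
    rw [finrank_quotient_span_eq_natDegree, natDegree_pow]
  have e2 : Module.finrank K (E[X] ⧸ Ideal.span {(X ^ N : E[X])}) = N * f.natDegree := by
    rw [← Module.finrank_mul_finrank K E, finrank_quotient_span_eq_natDegree, natDegree_X_pow, hd,
      mul_comm]
  have : FiniteDimensional E (E[X] ⧸ Ideal.span {(X ^ N : E[X])}) :=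
    (AdjoinRoot.powerBasis hX).finite
  have : FiniteDimensional K (E[X] ⧸ Ideal.span {(X ^ N : E[X])}) := Module.Finite.trans E _
  have : FiniteDimensional K (K[X] ⧸ Ideal.span {f ^ N}) := (AdjoinRoot.powerBasis hfN).finite
  have hsurj := (LinearMap.injective_iff_surjective_of_finrank_eq_finrank (f := ψ.toLinearMap)
    (e1.trans e2.symm)).1 hinj
  intro y
  obtain ⟨x, hx⟩ := hsurj y
  obtain ⟨x, rfl⟩ := Ideal.Quotient.mk_surjective x
  exact ⟨x, hx⟩

end

/-! ### From `f`-primary modules to `X`-primary modules over the residue field -/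

namespace FlagModule

variable {K E : Type} [Field K] [Field E] [Finite K] [Finite E] [Algebra K E] {s : ℕ}

theorem primaryCount_eq_count {q : ℕ} {g : K[X]} {l : Fin s → ℕ} (hq : q = Nat.card K) {N : ℕ}
    (hN : ∑ i, l i ≤ N) : primaryCount q g l =
      count fun M : FlagModule K[X] s => M.HasType q l ∧ ∀ x : M.carrier, g ^ N • x = 0 := by
  subst hq
  exact count_congr fun M => and_congr_right fun hM => hM.isPrimary_iff (K := K) hN

/-- With `N = ∑ i, l i`, an `f`-primary module of type `l` is killed by `f ^ N`, hence is a module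
over `E[X]/(X ^ N)`. As a space over `E` it has some type `m` there, which forces `l = d • m` with
`d` the degree of `f`. -/
theorem primaryCount_irreducible {f : K[X]} {α : E} (hf : Irreducible f) (hα : aeval α f = 0)
    (hd : f.natDegree = Module.finrank K E) (l : Fin s → ℕ) :
    ((∀ m, l ≠ f.natDegree • m) → primaryCount (Nat.card K) f l = 0) ∧
    ∀ m, l = f.natDegree • m → primaryCount (Nat.card K) f l = rho E m := by
  have hcard : Nat.card E = Nat.card K ^ f.natDegree := by
    rw [hd, Module.natCard_eq_pow_finrank (K := K)]
  -- Types are read off from cardinalities, so passing from `K` to `E` only rescales exponents.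
  have htype {R : Type} [CommRing R] {M : FlagModule R s} {m : Fin s → ℕ} :
      M.HasType (Nat.card E) m ↔ M.HasType (Nat.card K) (f.natDegree • m) := by
    simp only [HasType, hcard, ← pow_mul, Pi.smul_apply, smul_eq_mul]
  obtain ⟨φ, hφ, hk⟩ := exists_surjective_truncated hf (PerfectField.separable_of_irreducible hf)
    hα hd (∑ i, l i)
  have key : primaryCount (Nat.card K) f l = count fun
      M : FlagModule (E[X] ⧸ Ideal.span {(X ^ ∑ i, l i : E[X])}) s => M.HasType (Nat.card K) l := by
    rw [primaryCount_eq_count rfl le_rfl, count_restrict hφ hk]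
  constructor
  · intro hl
    rw [key]
    refine count_eq_zero fun M hM => ?_
    obtain ⟨m, hm⟩ := exists_hasType E M
    exact hl m (hM.unique Finite.one_lt_card (htype.1 hm))
  · intro m hm
    -- The truncation chosen for `l` over `K` is also long enough for `m` over `E`.
    have hle : ∑ i, m i ≤ ∑ i, l i := Finset.sum_le_sum fun i _ => by
      rw [hm]
      exact Nat.le_mul_of_pos_left _ hf.natDegree_pos
    rw [key, rho_eq_primaryCount, primaryCount_eq_count rfl hle,
      ← count_restrict (φ := Ideal.Quotient.mk (Ideal.span {(X ^ ∑ i, l i : E[X])}))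
        Ideal.Quotient.mk_surjective (fun r => by
        rw [Ideal.Quotient.eq_zero_iff_mem, Ideal.mem_span_singleton])]
    exact count_congr fun M => by rw [htype, ← hm]

end FlagModule

/-! ### Counting monic irreducible polynomials -/

section

variable (K : Type*) [Field K] [Finite K]

open Classical in
/-- The monic irreducible polynomials of degree `d` over a finite field. -/
noncomputable def monicIrreducibles (d : ℕ) : Finset K[X] :=
  (normalizedFactors (X ^ Nat.card K ^ d - X : K[X])).toFinset.filter fun f => f.natDegree = d

variable {K}

theorem X_pow_natCard_pow_sub_X_ne_zero {n : ℕ} (hn : n ≠ 0) :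
    (X ^ Nat.card K ^ n - X : K[X]) ≠ 0 :=
  FiniteField.X_pow_card_pow_sub_X_ne_zero K hn Finite.one_lt_card

open Classical in
theorem mem_normalizedFactors_X_pow_natCard_pow_sub_X {n : ℕ} (hn : n ≠ 0) {f : K[X]} :
    f ∈ normalizedFactors (X ^ Nat.card K ^ n - X : K[X]) ↔
      f.Monic ∧ Irreducible f ∧ f.natDegree ∣ n := by
  rw [Polynomial.mem_normalizedFactors_iff (X_pow_natCard_pow_sub_X_ne_zero hn)]
  constructor
  · rintro ⟨h1, h2, h3⟩
    exact ⟨h2, h1, (Irreducible.natDegree_dvd_iff_dvd_X_pow_card_pow_sub_X h1).2 h3⟩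
  · rintro ⟨h2, h1, h3⟩
    exact ⟨h1, h2, (Irreducible.natDegree_dvd_iff_dvd_X_pow_card_pow_sub_X h1).1 h3⟩

theorem mem_monicIrreducibles {d : ℕ} {f : K[X]} :
    f ∈ monicIrreducibles K d ↔ f.Monic ∧ Irreducible f ∧ f.natDegree = d := by
  classical
  rw [monicIrreducibles, Finset.mem_filter, Multiset.mem_toFinset]
  -- For `d = 0` the polynomial `X ^ q ^ d - X` is zero and has no factors, in agreement with the
  -- absence of irreducibles of degree `0`.
  rcases eq_or_ne d 0 with rfl | hd
  · constructor
    · simp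
    · rintro ⟨_, h2, h3⟩
      exact absurd h3 h2.natDegree_pos.ne'
  · rw [mem_normalizedFactors_X_pow_natCard_pow_sub_X hd]
    constructor
    · rintro ⟨⟨h1, h2, -⟩, h3⟩
      exact ⟨h1, h2, h3⟩
    · rintro ⟨h1, h2, h3⟩
      exact ⟨⟨h1, h2, h3.dvd⟩, h3⟩

/-- Gauss's count: `X ^ q ^ n - X` is the squarefree product of the monic irreducibles of degree
dividing `n`; compare degrees. -/
theorem sum_divisors_mul_card_monicIrreducibles {n : ℕ} (hn : n ≠ 0) :
    ∑ e ∈ n.divisors, e * (monicIrreducibles K e).card = Nat.card K ^ n := by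
  classical
  set g : K[X] := X ^ Nat.card K ^ n - X with hg
  have hg0 : g ≠ 0 := X_pow_natCard_pow_sub_X_ne_zero hn
  have hdeg : g.natDegree = Nat.card K ^ n :=
    FiniteField.X_pow_card_pow_sub_X_natDegree_eq K hn Finite.one_lt_card
  have hmon : g.Monic := by
    refine monic_X_pow_sub ?_
    rw [degree_X]
    exact_mod_cast Nat.one_lt_pow hn Finite.one_lt_card
  have hsq : Squarefree g := by
    have : Fintype K := Fintype.ofFinite K
    refine Separable.squarefree ?_
    obtain ⟨p, hp⟩ := CharP.exists K
    refine galois_poly_separable p _ ?_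
    refine dvd_pow ?_ hn
    rw [← CharP.cast_eq_zero_iff K p, Nat.card_eq_fintype_card]
    exact FiniteField.cast_card_eq_zero K
  have hprod : (normalizedFactors g).prod = g := by
    have := prod_normalizedFactors_eq hg0
    rwa [hmon.normalize_eq_self] at this
  have hnodup := (squarefree_iff_nodup_normalizedFactors hg0).1 hsq
  have hsum : ∑ f ∈ (normalizedFactors g).toFinset, f.natDegree = g.natDegree := by
    conv_rhs => rw [← hprod]
    rw [natDegree_multiset_prod _ (zero_notMem_normalizedFactors g), Finset.sum_multiset_map_count]
    refine Finset.sum_congr rfl fun f hf => ?_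
    rw [Multiset.count_eq_one_of_mem hnodup (Multiset.mem_toFinset.1 hf), one_smul]
  rw [← hdeg, ← hsum, ← Finset.sum_fiberwise_of_maps_to (t := n.divisors) (g := natDegree)]
  · refine Finset.sum_congr rfl fun e he => ?_
    rw [Finset.sum_congr rfl fun f hf => (Finset.mem_filter.1 hf).2, Finset.sum_const, smul_eq_mul,
      mul_comm]
    congr 2
    ext f
    rw [Finset.mem_filter, Multiset.mem_toFinset, mem_monicIrreducibles,
      mem_normalizedFactors_X_pow_natCard_pow_sub_X hn]
    constructor
    · rintro ⟨h1, h2, rfl⟩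
      exact ⟨⟨h1, h2, Nat.dvd_of_mem_divisors he⟩, rfl⟩
    · rintro ⟨⟨h1, h2, -⟩, h3⟩
      exact ⟨h1, h2, h3⟩
  · intro f hf
    rw [Multiset.mem_toFinset, mem_normalizedFactors_X_pow_natCard_pow_sub_X hn] at hf
    exact Nat.mem_divisors.2 ⟨hf.2.2, hn⟩

end

/-- The number of monic irreducible polynomials of degree `d` over the field with `q` elements is a
polynomial in `q`. -/
theorem exists_card_monicIrreducibles_eq_eval (d : ℕ) : ∃ P : ℚ[X], ∀ (K : Type) [Field K]
    [Finite K], ((monicIrreducibles K d).card : ℚ) = P.eval (Nat.card K : ℚ) := by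
  induction d using Nat.strong_induction_on with
  | _ d ih =>
    choose! P hP using ih
    rcases eq_or_ne d 0 with rfl | hd
    · refine ⟨0, fun K _ _ => ?_⟩
      rw [Finset.card_eq_zero.2]
      · simp
      · refine Finset.eq_empty_of_forall_notMem fun f hf => ?_
        obtain ⟨-, h2, h3⟩ := mem_monicIrreducibles.1 hf
        exact h2.natDegree_pos.ne' h3
    -- This is the degree identity solved for its term `e = d`; the proper divisors are covered by
    -- induction.
    · refine ⟨C (d : ℚ)⁻¹ * (X ^ d - ∑ e ∈ d.properDivisors, C (e : ℚ) * P e), fun K _ _ => ?_⟩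
      have h := congrArg (Nat.cast : ℕ → ℚ) (sum_divisors_mul_card_monicIrreducibles (K := K) hd)
      rw [← Nat.cons_self_properDivisors hd, Finset.sum_cons] at h
      push_cast at h
      have h2 : ∑ e ∈ d.properDivisors, (e : ℚ) * ((monicIrreducibles K e).card : ℚ) =
          ∑ e ∈ d.properDivisors, (e : ℚ) * (P e).eval (Nat.card K : ℚ) :=
        Finset.sum_congr rfl fun e he => by rw [hP e (Nat.mem_properDivisors.1 he).2 K]
      rw [h2] at h
      have hd' : (d : ℚ) ≠ 0 := Nat.cast_ne_zero.2 hd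
      simp only [eval_mul, eval_C, eval_sub, eval_pow, eval_X, eval_finsetSum]
      rw [← h]
      field_simp
      ring

/-! ### Block matrices and invertible matrices as primary conditions -/

section

variable {K : Type*} [Field K]

theorem exists_dvd_pow_of_irreducible_dvd {χ G : K[X]} (hχ : χ ≠ 0)
    (h : ∀ f : K[X], f.Monic → Irreducible f → f ∣ χ → f ∣ G) : ∃ n, χ ∣ G ^ n := by
  classical
  have key (S : Multiset K[X]) (hS : ∀ f ∈ S, f ∣ G) : S.prod ∣ G ^ Multiset.card S := by
    induction S using Multiset.induction_on with
    | empty => simp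
    | cons f S ih =>
      rw [Multiset.prod_cons, Multiset.card_cons, pow_succ']
      exact mul_dvd_mul (hS f (Multiset.mem_cons_self f S))
        (ih fun g hg => hS g (Multiset.mem_cons_of_mem hg))
  refine ⟨Multiset.card (normalizedFactors χ), (prod_normalizedFactors hχ).symm.dvd.trans
    (key _ fun f hf => ?_)⟩
  obtain ⟨h1, h2, h3⟩ := (Polynomial.mem_normalizedFactors_iff hχ).1 hf
  exact h f h2 h1 h3

theorem isCoprime_of_monic_irreducible {f g : K[X]} (hf : f.Monic) (hg : g.Monic)
    (hf' : Irreducible f) (hg' : Irreducible g) (h : f ≠ g) : IsCoprime f g :=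
  hf'.coprime_iff_not_dvd.2 fun hd =>
    h (eq_of_monic_of_associated hf hg (hf'.associated_of_dvd hg' hd))

variable [Finite K]

/-- By Cayley–Hamilton, only irreducible factors of the characteristic polynomial matter, and their
degrees are at most `∑ i, l i`. In this form `orbitCount_eq_primaryCount` applies. -/
theorem blockMatrices_eq {s : ℕ} (l : Fin s → ℕ) :
    blockMatrices K l = {A | A ∈ blockMatrices K l ∧ IsNilpotent (aeval A
      (∏ d ∈ Finset.range (∑ i, l i + 1), ∏ f ∈ monicIrreducibles K d, f))} := by
  ext A
  refine ⟨fun hA => ⟨hA, ?_⟩, fun hA => hA.1⟩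
  obtain ⟨n, hn⟩ := exists_dvd_pow_of_irreducible_dvd
    (G := ∏ d ∈ Finset.range (∑ i, l i + 1), ∏ f ∈ monicIrreducibles K d, f)
    A.charpoly_monic.ne_zero fun f h1 h2 h3 => by
      have hd := natDegree_le_of_dvd h3 A.charpoly_monic.ne_zero
      rw [A.charpoly_natDegree_eq_dim] at hd
      simp only [Fintype.card_sigma, Fintype.card_fin] at hd
      exact (Finset.dvd_prod_of_mem (fun f => f) (mem_monicIrreducibles.2 ⟨h1, h2, rfl⟩)).trans
        (Finset.dvd_prod_of_mem (fun d => ∏ f ∈ monicIrreducibles K d, f)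
          (Finset.mem_range.2 (Nat.lt_succ_of_le hd)))
  refine ⟨n, ?_⟩
  obtain ⟨c, hc⟩ := hn
  rw [← map_pow, hc, map_mul, A.aeval_self_charpoly, zero_mul]

open Classical in
theorem parabolicMatrices_eq {s : ℕ} (l : Fin s → ℕ) :
    parabolicMatrices K l = {A | A ∈ blockMatrices K l ∧ IsNilpotent (aeval A
      (∏ d ∈ Finset.range (∑ i, l i + 1), ∏ f ∈ (monicIrreducibles K d).erase X, f))} := by
  ext A
  set G : K[X] := ∏ d ∈ Finset.range (∑ i, l i + 1), ∏ f ∈ (monicIrreducibles K d).erase X, f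
    with hG
  constructor
  · rintro ⟨g, hg, rfl⟩
    set A : Matrix (BlockIndex l) (BlockIndex l) K := g.val
    refine ⟨hg, ?_⟩
    obtain ⟨n, c, hc⟩ := exists_dvd_pow_of_irreducible_dvd (G := G) A.charpoly_monic.ne_zero
      fun f h1 h2 h3 => by
        have hd := natDegree_le_of_dvd h3 A.charpoly_monic.ne_zero
        rw [A.charpoly_natDegree_eq_dim] at hd
        simp only [Fintype.card_sigma, Fintype.card_fin] at hd
        -- If `X` divided the characteristic polynomial, its constant term, hence the determinant,
        -- would vanish.
        have hX : f ≠ X := by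
          rintro rfl
          rw [X_dvd_iff] at h3
          have h4 := A.det_eq_sign_charpoly_coeff
          rw [h3, mul_zero] at h4
          have h5 : IsUnit A.det := (Matrix.isUnit_iff_isUnit_det A).1 g.isUnit
          exact h5.ne_zero h4
        exact (Finset.dvd_prod_of_mem (fun f => f)
          (Finset.mem_erase.2 ⟨hX, mem_monicIrreducibles.2 ⟨h1, h2, rfl⟩⟩)).trans
          (Finset.dvd_prod_of_mem (fun d => ∏ f ∈ (monicIrreducibles K d).erase X, f)
            (Finset.mem_range.2 (Nat.lt_succ_of_le hd)))
    exact ⟨n, by rw [← map_pow, hc, map_mul, A.aeval_self_charpoly, zero_mul]⟩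
  · rintro ⟨hA, n, hn⟩
    -- The Bézout relation evaluated at `A` exhibits an inverse of `A`.
    have hcop : IsCoprime X (G ^ n) := by
      refine IsCoprime.pow_right (IsCoprime.prod_right fun d _ => IsCoprime.prod_right fun f hf => ?_)
      obtain ⟨hX, hf⟩ := Finset.mem_erase.1 hf
      obtain ⟨h1, h2, -⟩ := mem_monicIrreducibles.1 hf
      refine (irreducible_X.coprime_iff_not_dvd).2 fun h => hX ?_
      exact (eq_of_monic_of_associated monic_X h1 (irreducible_X.associated_of_dvd h2 h)).symm
    obtain ⟨a, b, hab⟩ := hcop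
    have h := congrArg (aeval A) hab
    rw [map_add, map_mul, map_mul, map_pow, hn, mul_zero, add_zero, aeval_X, map_one] at h
    have hu : IsUnit A := IsUnit.of_mul_eq_one_right _ h
    exact ⟨hu.unit, hA, rfl⟩

end

/-! ### Generating functions -/

namespace FlagModule

section

variable {K : Type} [Field K] [Finite K] {s : ℕ}

theorem subsingleton_of_hasType_zero {R : Type} [CommRing R] {q : ℕ} {M : FlagModule R s}
    (hM : M.HasType q 0) : Subsingleton M.carrier := by
  have := hM.card
  simp only [Pi.zero_apply, Finset.sum_const_zero, pow_zero] at this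
  exact (Nat.card_eq_one_iff_unique.1 this).1

theorem primaryCount_zero {R : Type} [CommRing R] (q : ℕ) (g : R) :
    primaryCount q g (0 : Fin s → ℕ) = 1 := by
  let Z : FlagModule R s :=
    { carrier := PUnit
      flag := fun _ => ⊥
      mono := fun _ _ _ => le_rfl
      flag_zero := rfl
      flag_last := Subsingleton.elim _ _ }
  have hZ : Z.HasType q 0 ∧ Z.IsPrimary g := ⟨fun i => by simp [Z], 0, fun x => rfl⟩
  rw [primaryCount, count, Nat.card_eq_one_iff_unique]
  refine ⟨⟨fun a b => ?_⟩, ⟨Quotient.mk _ ⟨Z, hZ⟩⟩⟩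
  induction a using Quotient.inductionOn with | _ M =>
  induction b using Quotient.inductionOn with | _ N =>
  have := subsingleton_of_hasType_zero M.2.1
  have := subsingleton_of_hasType_zero N.2.1
  refine Quotient.sound ⟨LinearEquiv.ofLinearMap (0 : _ →ₗ[R] _) (0 : _ →ₗ[R] _)
    (Subsingleton.elim _ _) (Subsingleton.elim _ _), fun i x => ?_⟩
  rw [Subsingleton.elim x 0, map_zero]
  exact iff_of_true (zero_mem _) (zero_mem _)

theorem primaryCount_one {l : Fin s → ℕ} (hl : l ≠ 0) :
    primaryCount (Nat.card K) (1 : K[X]) l = 0 := by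
  refine count_eq_zero ?_
  rintro M ⟨hM, n, hn⟩
  have h1 : Subsingleton M.carrier := ⟨fun x y => by
    rw [← one_smul K[X] x, ← one_smul K[X] y, ← one_pow n, hn, hn]⟩
  have h2 := hM.card
  rw [Nat.card_of_subsingleton (0 : M.carrier)] at h2
  refine hl (funext fun i => ?_)
  have h3 : ∑ i, l i = 0 := by
    by_contra h
    exact (Nat.one_lt_pow h (Finite.one_lt_card (α := K))).ne h2
  exact Finset.sum_eq_zero_iff.1 h3 i (Finset.mem_univ i)

variable (K s) in
/-- The generating function of the numbers of classes of `g`-primary flag modules. -/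
noncomputable def primarySeries (g : K[X]) : MvPowerSeries (Fin s) ℚ :=
  fun l => primaryCount (Nat.card K) g l

theorem coeff_primarySeries (g : K[X]) (l : Fin s →₀ ℕ) :
    MvPowerSeries.coeff l (primarySeries K s g) = primaryCount (Nat.card K) g l := rfl

theorem primarySeries_one : primarySeries K s 1 = 1 := by
  classical
  ext l
  rw [coeff_primarySeries, MvPowerSeries.coeff_one]
  split_ifs with h
  · rw [h, Finsupp.coe_zero, primaryCount_zero, Nat.cast_one]
  · rw [primaryCount_one (fun h' => h (DFunLike.coe_injective h')), Nat.cast_zero]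

theorem primarySeries_mul {g h : K[X]} (hgh : IsCoprime g h) :
    primarySeries K s (g * h) = primarySeries K s g * primarySeries K s h := by
  classical
  ext l
  rw [MvPowerSeries.coeff_mul, coeff_primarySeries,
    primaryCount_mul K hgh (finite_primary g) (finite_primary h)]
  push_cast
  rfl

theorem primarySeries_prod {ι : Type*} (S : Finset ι) (f : ι → K[X])
    (hf : (S : Set ι).Pairwise fun i j => IsCoprime (f i) (f j)) :
    primarySeries K s (∏ i ∈ S, f i) = ∏ i ∈ S, primarySeries K s (f i) := by
  classical
  induction S using Finset.induction_on with
  | empty => simp [primarySeries_one]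
  | insert i S hi ih =>
    rw [Finset.prod_insert hi, Finset.prod_insert hi, primarySeries_mul, ih]
    · exact hf.mono (by simp)
    · exact IsCoprime.prod_right fun j hj => hf (by simp) (by simp [hj])
        (by rintro rfl; exact hi hj)

theorem primarySeries_prod_prod (I : Finset ℕ) (T : ℕ → Finset K[X])
    (hT : ∀ d, T d ⊆ monicIrreducibles K d) :
    primarySeries K s (∏ d ∈ I, ∏ f ∈ T d, f) =
      ∏ d ∈ I, ∏ f ∈ T d, primarySeries K s f := by
  have key {d e : ℕ} {f g : K[X]} (hf : f ∈ T d) (hg : g ∈ T e) (h : f ≠ g) : IsCoprime f g := by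
    obtain ⟨h1, h2, -⟩ := mem_monicIrreducibles.1 (hT d hf)
    obtain ⟨h3, h4, -⟩ := mem_monicIrreducibles.1 (hT e hg)
    exact isCoprime_of_monic_irreducible h1 h3 h2 h4 h
  rw [primarySeries_prod]
  · refine Finset.prod_congr rfl fun d _ => primarySeries_prod _ _ ?_
    exact fun f hf g hg h => key hf hg h
  · intro d _ e _ hde
    refine IsCoprime.prod_left fun f hf => IsCoprime.prod_right fun g hg => key hf hg ?_
    rintro rfl
    exact hde ((mem_monicIrreducibles.1 (hT d hf)).2.2.symm.trans
      (mem_monicIrreducibles.1 (hT e hg)).2.2)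

end

variable {s : ℕ}

variable (s) in
/-- The generating function of the numbers `rho E m`, with the exponent `m` scaled by `d`. -/
noncomputable def rhoSeries (E : Type) [Field E] (d : ℕ) : MvPowerSeries (Fin s) ℚ :=
  open Classical in fun l => if ∀ i, d ∣ l i then (rho E fun i => l i / d : ℚ) else 0

theorem rho_zero (E : Type) [Field E] [Finite E] : rho E (0 : Fin s → ℕ) = 1 := by
  rw [rho_eq_primaryCount, primaryCount_zero]

/-- The residue field `AdjoinRoot f` has `p ^ (k * d)` elements, so it is isomorphic to the Galois
field of that order. -/
theorem primarySeries_eq_rhoSeries {p k : ℕ} [Fact p.Prime] (hk : k ≠ 0) {d : ℕ}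
    {f : (GaloisField p k)[X]} (hf : f ∈ monicIrreducibles (GaloisField p k) d) :
    primarySeries (GaloisField p k) s f = rhoSeries s (GaloisField p (k * d)) d := by
  obtain ⟨-, hirr, rfl⟩ := mem_monicIrreducibles.1 hf
  have : Fact (Irreducible f) := ⟨hirr⟩
  have hd := hirr.natDegree_pos
  have hfd : FiniteDimensional (GaloisField p k) (AdjoinRoot f) :=
    (AdjoinRoot.powerBasis hirr.ne_zero).finite
  have hfr : Module.finrank (GaloisField p k) (AdjoinRoot f) = f.natDegree :=
    finrank_quotient_span_eq_natDegree
  have hfin : Finite (AdjoinRoot f) := Module.finite_of_finite (GaloisField p k)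
  let _ := Fintype.ofFinite (AdjoinRoot f)
  let _ := Fintype.ofFinite (GaloisField p (k * f.natDegree))
  have hcard : Fintype.card (AdjoinRoot f) = Fintype.card (GaloisField p (k * f.natDegree)) := by
    rw [← Nat.card_eq_fintype_card, ← Nat.card_eq_fintype_card,
      Module.natCard_eq_pow_finrank (K := GaloisField p k), hfr, GaloisField.card p k hk,
      GaloisField.card p _ (mul_ne_zero hk hd.ne'), pow_mul]
  let ε : AdjoinRoot f ≃+* GaloisField p (k * f.natDegree) := FiniteField.ringEquivOfCardEq hcard
  -- The algebra structure is transported along `ε`, so `ε` is automatically an algebra isomorphism.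
  let _ : Algebra (GaloisField p k) (GaloisField p (k * f.natDegree)) :=
    (ε.toRingHom.comp (algebraMap (GaloisField p k) (AdjoinRoot f))).toAlgebra
  let ε' : AdjoinRoot f ≃ₐ[GaloisField p k] GaloisField p (k * f.natDegree) :=
    AlgEquiv.ofRingEquiv (f := ε) fun _ => rfl
  have hα : aeval (ε' (AdjoinRoot.root f)) f = 0 := by
    have h := aeval_algHom_apply ε'.toAlgHom (AdjoinRoot.root f) f
    rw [AdjoinRoot.aeval_eq, AdjoinRoot.mk_self, map_zero] at h
    exact h
  have key (l : Fin s → ℕ) := primaryCount_irreducible hirr hα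
    (hfr.symm.trans ε'.toLinearEquiv.finrank_eq) l
  ext l
  rw [coeff_primarySeries]
  change _ = open Classical in (if ∀ i, f.natDegree ∣ l i then
    (rho (GaloisField p (k * f.natDegree)) fun i => l i / f.natDegree : ℚ) else 0)
  split_ifs with h
  · rw [(key l).2 _ (funext fun i => (Nat.mul_div_cancel' (h i)).symm)]
  · rw [(key l).1 fun m hm => h fun i => ⟨m i, congrFun hm i⟩, Nat.cast_zero]

end FlagModule

/-! ### Polynomial dependence on the prime power -/

/-- The exponents `(p, k)` of the prime powers `p ^ k`. -/
abbrev PrimePowerIndex : Type := {x : ℕ × ℕ // x.1.Prime ∧ x.2 ≠ 0}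

namespace PrimePowerIndex

/-- The prime power given by its exponents. -/
def val (x : PrimePowerIndex) : ℕ := x.1.1 ^ x.1.2

instance (x : PrimePowerIndex) : Fact x.1.1.Prime := ⟨x.2.1⟩

/-- Polynomials as functions of the prime power. -/
noncomputable instance : Algebra ℚ[X] (PrimePowerIndex → ℚ) :=
  (RingHom.pi fun x : PrimePowerIndex => evalRingHom (x.val : ℚ)).toAlgebra

theorem smul_apply (P : ℚ[X]) (f : PrimePowerIndex → ℚ) (x : PrimePowerIndex) :
    (P • f) x = P.eval (x.val : ℚ) * f x := rfl

variable {s : ℕ}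

/-- The product of the numbers `rho` of a family, as a function of the prime power. -/
noncomputable def rhoProd (J : Multiset ((Fin s → ℕ) × ℕ)) (x : PrimePowerIndex) : ℚ :=
  (J.map fun y => (rho (GaloisField x.1.1 (x.1.2 * y.2)) y.1 : ℚ)).prod

/-- The linear combinations with polynomial coefficients of the products `rhoProd J`, where `J`
runs through the decompositions of `l`. -/
noncomputable def rhoSpan (l : Fin s → ℕ) : Submodule ℚ[X] (PrimePowerIndex → ℚ) :=
  Submodule.span ℚ[X] (rhoProd '' decompositions l)

theorem one_mem_rhoSpan : (1 : PrimePowerIndex → ℚ) ∈ rhoSpan (0 : Fin s → ℕ) :=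
  Submodule.subset_span ⟨0, by simp [decompositions], funext fun x => by simp [rhoProd]⟩

theorem rho_mem_rhoSpan {m : Fin s → ℕ} (hm : m ≠ 0) {d : ℕ} (hd : d ≠ 0) :
    (fun x : PrimePowerIndex => (rho (GaloisField x.1.1 (x.1.2 * d)) m : ℚ)) ∈ rhoSpan (d • m) :=
  Submodule.subset_span ⟨{(m, d)}, by simp [decompositions, hm, Nat.one_le_iff_ne_zero, hd],
    funext fun x => by simp [rhoProd]⟩

/-- Concatenating decompositions of `l` and `l'` gives a decomposition of `l + l'`, and `rhoProd` is
multiplicative. -/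
theorem mul_mem_rhoSpan {l l' : Fin s → ℕ} {f g : PrimePowerIndex → ℚ} (hf : f ∈ rhoSpan l)
    (hg : g ∈ rhoSpan l') : f * g ∈ rhoSpan (l + l') := by
  have h := Submodule.mul_mem_mul hf hg
  rw [rhoSpan, rhoSpan, Submodule.span_mul_span] at h
  refine Submodule.span_mono ?_ h
  rintro _ ⟨_, ⟨J, hJ, rfl⟩, _, ⟨J', hJ', rfl⟩, rfl⟩
  refine ⟨J + J', ⟨fun x hx => ?_, ?_⟩, funext fun x => ?_⟩
  · rcases Multiset.mem_add.1 hx with h | h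
    exacts [hJ.1 x h, hJ'.1 x h]
  · rw [Multiset.map_add, Multiset.sum_add, hJ.2, hJ'.2]
  · simp [rhoProd]

/-- The coefficients of the power series lie in the spans `rhoSpan`. -/
def IsGraded (Φ : PrimePowerIndex → MvPowerSeries (Fin s) ℚ) : Prop :=
  ∀ l : Fin s →₀ ℕ, (fun x => MvPowerSeries.coeff l (Φ x)) ∈ rhoSpan l

theorem IsGraded.one : IsGraded (1 : PrimePowerIndex → MvPowerSeries (Fin s) ℚ) := fun l => by
  classical
  simp only [Pi.one_apply, MvPowerSeries.coeff_one]
  split_ifs with h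
  · subst h
    exact one_mem_rhoSpan
  · exact zero_mem _

theorem IsGraded.mul {Φ Ψ : PrimePowerIndex → MvPowerSeries (Fin s) ℚ} (hΦ : IsGraded Φ)
    (hΨ : IsGraded Ψ) : IsGraded (Φ * Ψ) := fun l => by
  classical
  have : (fun x => MvPowerSeries.coeff l ((Φ * Ψ) x)) =
      ∑ p ∈ Finset.HasAntidiagonal.antidiagonal l,
        (fun x => MvPowerSeries.coeff p.1 (Φ x)) * (fun x => MvPowerSeries.coeff p.2 (Ψ x)) := by
    ext x
    simp [MvPowerSeries.coeff_mul]
  rw [this]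
  refine Submodule.sum_mem _ fun p hp => ?_
  rw [← Finset.HasAntidiagonal.mem_antidiagonal.1 hp, Finsupp.coe_add]
  exact mul_mem_rhoSpan (hΦ p.1) (hΨ p.2)

theorem IsGraded.pow {Φ : PrimePowerIndex → MvPowerSeries (Fin s) ℚ} (hΦ : IsGraded Φ) (n : ℕ) :
    IsGraded (Φ ^ n) := by
  induction n with
  | zero => simpa using IsGraded.one
  | succ n ih => rw [pow_succ]; exact ih.mul hΦ

theorem IsGraded.prod {ι : Type*} (S : Finset ι)
    (Φ : ι → PrimePowerIndex → MvPowerSeries (Fin s) ℚ) (h : ∀ i ∈ S, IsGraded (Φ i)) :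
    IsGraded (∏ i ∈ S, Φ i) :=
  Finset.prod_induction Φ IsGraded (fun _ _ => IsGraded.mul) IsGraded.one h

/-- Powers with exponent a polynomial in the prime power preserve gradedness. -/
theorem IsGraded.one_add_pow {Φ : PrimePowerIndex → MvPowerSeries (Fin s) ℚ} (hΦ : IsGraded Φ)
    (h0 : ∀ x, MvPowerSeries.constantCoeff (Φ x) = 0) {ν : PrimePowerIndex → ℕ} {P : ℚ[X]}
    (hν : ∀ x, (ν x : ℚ) = P.eval (x.val : ℚ)) : IsGraded fun x => (1 + Φ x) ^ ν x := fun l => by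
  classical
  -- Since `Φ x ^ j` has order at least `j`, the binomial expansion can be cut at `l.degree`,
  -- uniformly in `x`. The binomial coefficient of `ν x` over `j` is a polynomial in `ν x`, hence in
  -- the prime power.
  have : (fun x => MvPowerSeries.coeff l ((1 + Φ x) ^ ν x)) =
      ∑ j ∈ Finset.range (l.degree + 1),
        (C ((j.factorial : ℚ)⁻¹) * (descPochhammer ℚ j).comp P) •
          fun x => MvPowerSeries.coeff l ((Φ ^ j) x) := by
    ext x
    have hvanish (j : ℕ) (hj : l.degree < j) : MvPowerSeries.coeff l (Φ x ^ j) = 0 :=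
      MvPowerSeries.coeff_of_lt_order ((Nat.cast_lt.2 hj).trans_le
        (MvPowerSeries.le_order_pow_of_constantCoeff_eq_zero j (h0 x)))
    have hterm (j : ℕ) : (C ((j.factorial : ℚ)⁻¹) * (descPochhammer ℚ j).comp P).eval (x.val : ℚ) =
        ((ν x).choose j : ℚ) := by
      rw [Nat.cast_choose_eq_descPochhammer_div, eval_mul, eval_C, eval_comp, hν]
      field_simp
    simp only [Finset.sum_apply, smul_apply, hterm, Pi.pow_apply]
    rw [add_comm, add_pow, map_sum]
    simp only [one_pow, mul_one]
    have hc (j : ℕ) : MvPowerSeries.coeff l (Φ x ^ j * ((ν x).choose j : MvPowerSeries (Fin s) ℚ)) =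
        ((ν x).choose j : ℚ) * MvPowerSeries.coeff l (Φ x ^ j) := by
      rw [← nsmul_eq_mul', map_nsmul, nsmul_eq_mul]
    simp only [hc]
    -- Both sums are extended to a common range: extra terms vanish through the binomial coefficient
    -- on one side and through the order of `Φ x ^ j` on the other.
    rw [Finset.sum_subset (Finset.range_mono (Nat.le_add_right (ν x + 1) (l.degree + 1))),
      Finset.sum_subset (Finset.range_mono (Nat.le_add_left (l.degree + 1) (ν x + 1)))]
    · intro j _ hj
      rw [hvanish j (by simpa using hj), mul_zero]
    · intro j _ hj
      rw [Nat.choose_eq_zero_of_lt (by simpa using hj), Nat.cast_zero, zero_mul]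
  rw [this]
  exact Submodule.sum_mem _ fun j _ => Submodule.smul_mem _ _ (hΦ.pow j l)

/-- A nonzero coefficient away from degree `0` is a single `rho`, from a one-element family. The
constant term `1`, which comes from the zero tuple excluded from decompositions, is subtracted. -/
theorem isGraded_rhoSeries_sub_one {d : ℕ} (hd : d ≠ 0) :
    IsGraded fun x : PrimePowerIndex =>
      FlagModule.rhoSeries s (GaloisField x.1.1 (x.1.2 * d)) d - 1 := fun l => by
  classical
  have hc (x : PrimePowerIndex) : MvPowerSeries.coeff l
      (FlagModule.rhoSeries s (GaloisField x.1.1 (x.1.2 * d)) d) =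
      if ∀ i, d ∣ l i then (rho (GaloisField x.1.1 (x.1.2 * d)) fun i => l i / d : ℚ) else 0 := by
    change FlagModule.rhoSeries s (GaloisField x.1.1 (x.1.2 * d)) d l = _
    unfold FlagModule.rhoSeries
    congr
  simp only [map_sub, MvPowerSeries.coeff_one, hc]
  rcases eq_or_ne l 0 with rfl | hl
  · refine (congrArg (· ∈ rhoSpan _) (funext fun x => ?_)).mpr (zero_mem (rhoSpan (0 : Fin s → ℕ)))
    have := FlagModule.rho_zero (s := s) (GaloisField x.1.1 (x.1.2 * d))
    simp only [Finsupp.coe_zero, Pi.zero_apply, dvd_zero, implies_true, if_true, Nat.zero_div,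
      ← Pi.zero_def, this, Nat.cast_one, sub_self]
  · simp only [hl, if_false, sub_zero]
    split_ifs with h
    · have hl' : (l : Fin s → ℕ) = d • fun i => l i / d :=
        funext fun i => (Nat.mul_div_cancel' (h i)).symm
      have hm : (fun i => l i / d) ≠ 0 := fun h0 => hl (DFunLike.coe_injective (by
        rw [hl', h0, smul_zero]; rfl))
      have hmem := rho_mem_rhoSpan hm hd
      rwa [← hl'] at hmem
    · exact zero_mem _

theorem isGraded_rhoSeries_pow {d : ℕ} (hd : d ≠ 0) {ν : PrimePowerIndex → ℕ} {P : ℚ[X]}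
    (hν : ∀ x, (ν x : ℚ) = P.eval (x.val : ℚ)) : IsGraded fun x : PrimePowerIndex =>
      FlagModule.rhoSeries s (GaloisField x.1.1 (x.1.2 * d)) d ^ ν x := by
  have h := (isGraded_rhoSeries_sub_one (s := s) hd).one_add_pow (fun x => ?_) hν
  · simpa only [add_sub_cancel] using h
  · rw [map_sub, map_one, ← MvPowerSeries.coeff_zero_eq_constantCoeff_apply]
    have : MvPowerSeries.coeff 0 (FlagModule.rhoSeries s (GaloisField x.1.1 (x.1.2 * d)) d) =
        (1 : ℚ) := by
      change FlagModule.rhoSeries s (GaloisField x.1.1 (x.1.2 * d)) d 0 = _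
      have := FlagModule.rho_zero (s := s) (GaloisField x.1.1 (x.1.2 * d))
      simp only [FlagModule.rhoSeries, Finsupp.coe_zero, Pi.zero_apply, dvd_zero, implies_true,
        if_true, Nat.zero_div, ← Pi.zero_def, this, Nat.cast_one]
    rw [this, sub_self]

/-- The number of classes of flag modules all of whose primary components belong to the given
sets of irreducible polynomials. -/
theorem primaryCount_prod_mem_rhoSpan (l : Fin s →₀ ℕ) (n : ℕ)
    (T : ∀ x : PrimePowerIndex, ℕ → Finset (GaloisField x.1.1 x.1.2)[X])
    (hT : ∀ x d, T x d ⊆ monicIrreducibles (GaloisField x.1.1 x.1.2) d)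
    (hP : ∀ d, ∃ P : ℚ[X], ∀ x, ((T x d).card : ℚ) = P.eval (x.val : ℚ)) :
    (fun x : PrimePowerIndex => (FlagModule.primaryCount (Nat.card (GaloisField x.1.1 x.1.2))
      (∏ d ∈ Finset.range n, ∏ f ∈ T x d, f) l : ℚ)) ∈ rhoSpan l := by
  have h : IsGraded (∏ d ∈ Finset.range n, fun x : PrimePowerIndex =>
      FlagModule.rhoSeries s (GaloisField x.1.1 (x.1.2 * d)) d ^ (T x d).card) := by
    refine IsGraded.prod _ _ fun d _ => ?_
    rcases eq_or_ne d 0 with rfl | hd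
    · have (x : PrimePowerIndex) : (T x 0).card = 0 :=
        Finset.card_eq_zero.2 (Finset.eq_empty_of_forall_notMem fun f hf => by
          obtain ⟨-, h2, h3⟩ := mem_monicIrreducibles.1 (hT x 0 hf)
          exact h2.natDegree_pos.ne' h3)
      simp only [this, pow_zero]
      exact IsGraded.one
    · obtain ⟨P, hP⟩ := hP d
      exact isGraded_rhoSeries_pow hd hP
  refine (congrArg (· ∈ rhoSpan (l : Fin s → ℕ)) (funext fun x => ?_)).mpr (h l)
  rw [← FlagModule.coeff_primarySeries, FlagModule.primarySeries_prod_prod _ _ (hT x),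
    Finset.prod_apply]
  congr 1
  refine Finset.prod_congr rfl fun _ _ => ?_
  -- All polynomials of one degree contribute the same series, so their product is a power.
  rw [Finset.prod_congr rfl fun f hf =>
    FlagModule.primarySeries_eq_rhoSeries (s := s) x.2.2 (hT x _ hf), Finset.prod_const]

theorem natCard_galoisField (x : PrimePowerIndex) :
    Nat.card (GaloisField x.1.1 x.1.2) = x.val := GaloisField.card _ _ x.2.2

theorem orbitCount_blockMatrices_mem_rhoSpan (l : Fin s → ℕ) :
    (fun x : PrimePowerIndex => (orbitCount (parabolic (GaloisField x.1.1 x.1.2) l)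
      (blockMatrices (GaloisField x.1.1 x.1.2) l) : ℚ)) ∈ rhoSpan l := by
  have h := primaryCount_prod_mem_rhoSpan (Finsupp.equivFunOnFinite.symm l) (∑ i, l i + 1)
    (fun x => monicIrreducibles (GaloisField x.1.1 x.1.2)) (fun _ _ => subset_rfl)
    (fun d => by
      obtain ⟨P, hP⟩ := exists_card_monicIrreducibles_eq_eval d
      exact ⟨P, fun x => by rw [hP, natCard_galoisField]⟩)
  refine (congrArg (· ∈ rhoSpan l) (funext fun x => ?_)).mpr h
  rw [blockMatrices_eq, FlagModule.orbitCount_eq_primaryCount]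
  rfl

theorem orbitCount_parabolicMatrices_mem_rhoSpan (l : Fin s → ℕ) :
    (fun x : PrimePowerIndex => (orbitCount (parabolic (GaloisField x.1.1 x.1.2) l)
      (parabolicMatrices (GaloisField x.1.1 x.1.2) l) : ℚ)) ∈ rhoSpan l := by
  classical
  have hX (x : PrimePowerIndex) (d : ℕ) :
      (X : (GaloisField x.1.1 x.1.2)[X]) ∈ monicIrreducibles (GaloisField x.1.1 x.1.2) d ↔
        d = 1 := by
    rw [mem_monicIrreducibles, natDegree_X]
    exact ⟨fun h => h.2.2.symm, fun h => ⟨monic_X, irreducible_X, h.symm⟩⟩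
  have h := primaryCount_prod_mem_rhoSpan (Finsupp.equivFunOnFinite.symm l) (∑ i, l i + 1)
    (fun x d => (monicIrreducibles (GaloisField x.1.1 x.1.2) d).erase X)
    (fun _ _ => Finset.erase_subset _ _)
    (fun d => by
      obtain ⟨P, hP⟩ := exists_card_monicIrreducibles_eq_eval d
      rcases eq_or_ne d 1 with rfl | hd
      -- Only degree `1` loses a polynomial, namely `X`.
      · refine ⟨P - 1, fun x => ?_⟩
        rw [Finset.cast_card_erase_of_mem ((hX x 1).2 rfl), hP, natCard_galoisField]
        simp
      · refine ⟨P, fun x => ?_⟩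
        rw [Finset.erase_eq_of_notMem (fun h => hd ((hX x d).1 h)), hP, natCard_galoisField])
  refine (congrArg (· ∈ rhoSpan l) (funext fun x => ?_)).mpr h
  rw [parabolicMatrices_eq, FlagModule.orbitCount_eq_primaryCount]
  congr

/-- The span is taken in the functions of the prime power, so one family of coefficients serves all
prime powers at once. -/
theorem exists_coefficients_of_mem_rhoSpan {l : Fin s → ℕ} {f : PrimePowerIndex → ℚ}
    (hf : f ∈ rhoSpan l) : ∃ a : decompositions l → ℚ[X], ∀ x : PrimePowerIndex,
      f x = ∑ J : decompositions l, (a J).eval (x.val : ℚ) * rhoProd J.1 x := by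
  rw [rhoSpan, Set.image_eq_range, Submodule.mem_span_range_iff_exists_fun] at hf
  obtain ⟨a, rfl⟩ := hf
  refine ⟨a, fun x => ?_⟩
  rw [Finset.sum_apply]
  exact Finset.sum_congr rfl fun J _ => smul_apply _ _ _

end PrimePowerIndex

theorem mainTheorem7 {s : ℕ} (l : Fin s → ℕ) :
    ∃ a b : decompositions l → Polynomial ℚ,
      ∀ (p k : ℕ) [Fact p.Prime], k ≠ 0 →
        (orbitCount (parabolic (GaloisField p k) l) (parabolicMatrices (GaloisField p k) l) : ℚ) =
            ∑ J : decompositions l, (a J).eval ((p ^ k : ℕ) : ℚ) *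
              (J.1.map fun x => (rho (GaloisField p (k * x.2)) x.1 : ℚ)).prod ∧
        (orbitCount (parabolic (GaloisField p k) l) (blockMatrices (GaloisField p k) l) : ℚ) =
            ∑ J : decompositions l, (b J).eval ((p ^ k : ℕ) : ℚ) *
              (J.1.map fun x => (rho (GaloisField p (k * x.2)) x.1 : ℚ)).prod := by
  obtain ⟨a, ha⟩ := PrimePowerIndex.exists_coefficients_of_mem_rhoSpan
    (PrimePowerIndex.orbitCount_parabolicMatrices_mem_rhoSpan l)
  obtain ⟨b, hb⟩ := PrimePowerIndex.exists_coefficients_of_mem_rhoSpan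
    (PrimePowerIndex.orbitCount_blockMatrices_mem_rhoSpan l)
  exact ⟨a, b, fun p k hp hk =>
    ⟨ha ⟨(p, k), hp.out, hk⟩, hb ⟨(p, k), hp.out, hk⟩⟩⟩
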